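/- For $n\ge 0$, the book $B_n$ is the graph consisting of $n$ triangles all sharing a common edge. For finite graphs $G$ and $H$, the Ramsey number $r(G,H)$ is the smallest positive integer $N$ such that every red/blue colouring of the edges of the complete graph $K_N$ contains a red copy of $G$ or a blue copy of $H$. Theorem. Let $\alpha$ be a fixed real number with $1/6\le\alpha\le 1/4$. Then, as $n\to\infty$, $$r(B_{\lceil\alpha n\rceil},B_n)\le\left(\frac32+3\alpha\right)n+o(n).$$ Moreover, if $\alpha=1/6$ or $\alpha=1/4$, then the inequality is asymptotically tight, that is, $$r(B_{\lceil\alpha n\rceil},B_n)=\left(\frac32+3\alpha\right)n+o(n).$$ -/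

import Mathlib

open Filter Asymptotics

/-- The book `B_n`: `n` triangles all sharing a common edge. The two vertices of the common edge
(the spine) are indexed by `Fin 2` and the `n` remaining vertices (the pages) by `Fin n`;
two distinct vertices are adjacent exactly when at least one of them lies on the spine. -/
def book (n : ℕ) : SimpleGraph (Fin 2 ⊕ Fin n) where
  Adj x y := x ≠ y ∧ (x.isLeft = true ∨ y.isLeft = true)
  symm := ⟨fun _ _ h => ⟨h.1.symm, h.2.symm⟩⟩
  loopless := ⟨fun _ h => h.1 rfl⟩

/-- Every red/blue colouring of the edges of the complete graph `K_N` contains a red copy of `G`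
or a blue copy of `H`. A colouring is given by its graph `R` of red edges, and the blue
edges are those of the complement. Copies need not be induced. -/
def RamseyArrows {V W : Type*} (N : ℕ) (G : SimpleGraph V) (H : SimpleGraph W) : Prop :=
  ∀ R : SimpleGraph (Fin N), G.IsContained R ∨ H.IsContained Rᶜ

/-- The Ramsey number `r(G, H)`: the smallest positive integer `N` such that every red/blue
colouring of the edges of `K_N` contains a red `G` or a blue `H`. For graphs on finite vertex types
such an `N` exists (`isLeast_ramseyNumber`), so no junk value occurs. -/
noncomputable def ramseyNumber {V W : Type*} (G : SimpleGraph V) (H : SimpleGraph W) : ℕ :=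
  sInf {N : ℕ | 0 < N ∧ RamseyArrows N G H}

theorem exists_clique_or_compl_clique (a b : ℕ) : ∃ N : ℕ, ∀ (V : Type) (R : SimpleGraph V)
    (s : Finset V), N ≤ s.card →
      (∃ t, t ⊆ s ∧ R.IsNClique a t) ∨ (∃ t, t ⊆ s ∧ Rᶜ.IsNClique b t) := by
  classical
  induction a generalizing b with
  | zero => exact ⟨0, fun V R s _ => Or.inl ⟨∅, by simp, by simp⟩⟩
  | succ a iha =>
    induction b with
    | zero => exact ⟨0, fun V R s _ => Or.inr ⟨∅, by simp, by simp⟩⟩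
    | succ b ihb =>
      obtain ⟨N₁, h₁⟩ := iha (b + 1)
      obtain ⟨N₂, h₂⟩ := ihb
      refine ⟨N₁ + N₂ + 1, fun V R s hs => ?_⟩
      obtain ⟨v, hv⟩ : s.Nonempty := Finset.card_pos.mp (by omega)
      have hsplit := Finset.card_filter_add_card_filter_not (s := s.erase v) (fun w => R.Adj v w)
      rw [Finset.card_erase_of_mem hv] at hsplit
      have hsub (p : V → Prop) [DecidablePred p] : (s.erase v).filter p ⊆ s :=
        (Finset.filter_subset _ _).trans (Finset.erase_subset _ _)
      rcases (by omega : N₁ ≤ ((s.erase v).filter (fun w => R.Adj v w)).card ∨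
          N₂ ≤ ((s.erase v).filter (fun w => ¬ R.Adj v w)).card) with h | h
      · rcases h₁ V R _ h with ⟨t, hts, ht⟩ | ⟨t, hts, ht⟩
        · refine Or.inl ⟨insert v t, Finset.insert_subset hv (hts.trans (hsub _)),
            ht.insert fun w hw => ?_⟩
          exact (Finset.mem_filter.mp (hts hw)).2
        · exact Or.inr ⟨t, hts.trans (hsub _), ht⟩
      · rcases h₂ V R _ h with ⟨t, hts, ht⟩ | ⟨t, hts, ht⟩
        · exact Or.inl ⟨t, hts.trans (hsub _), ht⟩
        · refine Or.inr ⟨insert v t, Finset.insert_subset hv (hts.trans (hsub _)),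
            ht.insert fun w hw => ?_⟩
          have hw' := Finset.mem_filter.mp (hts hw)
          exact (SimpleGraph.compl_adj R v w).mpr
            ⟨(Finset.ne_of_mem_erase hw'.1).symm, hw'.2⟩

theorem isContained_of_isNClique {V X : Type*} [Finite V] (G : SimpleGraph V)
    (R : SimpleGraph X) (t : Finset X) (ht : R.IsNClique (Nat.card V) t) : G.IsContained R := by
  have e : V ≃ t := (Finite.equivFin V).trans (Finset.equivFinOfCardEq ht.card_eq).symm
  have hinj : Function.Injective fun v => (e v : X) :=
    fun v w h => e.injective (Subtype.ext h)
  exact ⟨⟨⟨fun v => (e v : X), fun {v w} h =>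
    ht.isClique (e v).2 (e w).2 (fun h' => h.ne (hinj h'))⟩, hinj⟩⟩

/-- Ramsey's theorem: the Ramsey number of two finite graphs is a genuine minimum. -/
theorem isLeast_ramseyNumber {V W : Type*} [Finite V] [Finite W]
    (G : SimpleGraph V) (H : SimpleGraph W) :
    IsLeast {N : ℕ | 0 < N ∧ RamseyArrows N G H} (ramseyNumber G H) := by
  have hne : {N : ℕ | 0 < N ∧ RamseyArrows N G H}.Nonempty := by
    obtain ⟨N, hN⟩ := exists_clique_or_compl_clique (Nat.card V) (Nat.card W)
    refine ⟨N + 1, Nat.succ_pos _, fun R => ?_⟩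
    rcases hN _ R Finset.univ (by simp) with ⟨t, -, ht⟩ | ⟨t, -, ht⟩
    · exact Or.inl (isContained_of_isNClique G R t ht)
    · exact Or.inr (isContained_of_isNClique H Rᶜ t ht)
  exact ⟨Nat.sInf_mem hne, fun N hN => Nat.sInf_le hN⟩

/-!
The Ramsey number of two books is a question about codegrees: a graph contains `B_m` if and only if
some edge has at least `m` common neighbours.

**Upper bound.** Let a graph on `N` vertices have codegrees at most `ρ N` on edges and at most `x N`
in the complement on non-edges, where `3 x + 6 ρ < 2` and `x < 1 / 2` by a fixed margin; for
`N = (3 / 2 + 3 α + ε) n`, with `ρ = α n / N` and `x ≈ n / N`, this is what `α ≥ 1 / 6` gives. For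
large `N` this is impossible (`exists_forall_not_codegBounded`). Regularity is not needed: a large
clique or independent set `Q` of bounded size plays the role of a cluster, and averaging the
codegree condition over the pairs in `Q` bounds the second moment of the densities `dens G Q w` of
all vertices `w` to `Q`. Sums of squares exclude two configurations: two large cliques without edges
between them (`CodegBounded.not_two_cliques`) and three large independent sets that are completely
joined to each other (`CodegBounded.not_three_independent`). The second one is where the constant
`3 / 2 + 3 α` comes from.

Let `U` be the union of a maximal family of disjoint cliques of a large fixed size. By the first
exclusion `U` is nearly complete, which limits the size of `U` and the densities from outside to `U`
(`exists_clique_part`). Outside `U` large sets contain large independent sets, by Ramsey's theorem,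
so by the second exclusion the graph is nearly triangle-free there. For two completely joined
independent sets `P`, `Q` outside `U`, nearly every vertex outside `U` is thus adjacent to few
vertices of `P` or to few of `Q`, and contributes at least about `1` to the sum of the codegree
conditions for `P` and `Q`. Since `x < 1 / 2`, the set `U` cannot be negligible, and the densities
`a`, `b` of `P`, `Q` to `U` satisfy `(1 - a) ^ 2 + (1 - b) ^ 2 < 1`
(`CodegBounded.card_add_le_of_dens_ge`). Taking for `Q` an independent set whose density to `U` is
nearly minimal, at least half of the vertices outside `U` can play the role of `P`. So the mean
square of the densities to `U` is at least `(√2 - 1) ^ 2 / 2 > 1 / 12`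
(`mul_card_sub_le_sum_sq`), which is more than the near-completeness of `U` allows.

**Lower bounds.** For `α = 1 / 6` the red graph is complete bipartite with parts of size `n`. For
`α = 1 / 4` it is quasirandom of density `1 / 3`: its vertices are the elements of `F × Y`, where
`F` is the field with `3 ^ j` elements and `Y ⊆ F`, and adjacency is the vanishing of an
`𝔽₃`-linear functional on a symmetric function `pairing` that is affine in each of the two
`F`-coordinates. For two given vertices, and up to at most `16` values of the
`Y`-coordinate, the two values of the functional are exactly equidistributed over `𝔽₃ × 𝔽₃`
(`nine_mul_card_filter_pairing_le`). Since the size of `Y` is free, the number of vertices can be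
brought close to `9 n / 4` for every large `n`.
-/

namespace BookRamsey

open scoped Classical

/-! ### Edge densities and codegrees -/

section Density

variable {V : Type*}

/-- The indicator of adjacency, as a real number. -/
noncomputable def adjInd (G : SimpleGraph V) (u v : V) : ℝ := if G.Adj u v then 1 else 0

/-- The density of edges from the vertex `w` to the vertex set `Q`: the average over `Q` of the
indicator of being adjacent to `w`. It is `0` if `Q` is empty. -/
noncomputable def dens (G : SimpleGraph V) (Q : Finset V) (w : V) : ℝ :=
  (∑ v ∈ Q, adjInd G w v) / Q.card

theorem adjInd_comm (G : SimpleGraph V) (u v : V) : adjInd G u v = adjInd G v u := by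
  simp [adjInd, G.adj_comm]

theorem adjInd_nonneg (G : SimpleGraph V) (u v : V) : 0 ≤ adjInd G u v := by
  unfold adjInd; split_ifs <;> norm_num

theorem adjInd_le_one (G : SimpleGraph V) (u v : V) : adjInd G u v ≤ 1 := by
  unfold adjInd; split_ifs <;> norm_num

theorem dens_nonneg (G : SimpleGraph V) (Q : Finset V) (w : V) : 0 ≤ dens G Q w :=
  div_nonneg (Finset.sum_nonneg fun _ _ => adjInd_nonneg _ _ _) (Nat.cast_nonneg _)

theorem dens_le_one (G : SimpleGraph V) (Q : Finset V) (w : V) : dens G Q w ≤ 1 := by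
  refine div_le_one_of_le₀ ?_ (Nat.cast_nonneg _)
  calc ∑ v ∈ Q, adjInd G w v ≤ ∑ v ∈ Q, (1 : ℝ) :=
        Finset.sum_le_sum fun _ _ => adjInd_le_one _ _ _
    _ = Q.card := by simp

theorem sum_adjInd (G : SimpleGraph V) (Q : Finset V) (w : V) :
    ∑ v ∈ Q, adjInd G w v = ((Q.filter fun v => G.Adj w v).card : ℝ) := by
  simp [adjInd]

theorem dens_mul_card (G : SimpleGraph V) {Q : Finset V} (hQ : Q.Nonempty) (w : V) :
    dens G Q w * Q.card = ∑ v ∈ Q, adjInd G w v := by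
  have : (Q.card : ℝ) ≠ 0 := by exact_mod_cast hQ.card_pos.ne'
  unfold dens; field_simp

theorem one_sub_dens (G : SimpleGraph V) {Q : Finset V} (hQ : Q.Nonempty) (w : V) :
    1 - dens G Q w = (∑ v ∈ Q, (1 - adjInd G w v)) / Q.card := by
  have : (Q.card : ℝ) ≠ 0 := by exact_mod_cast hQ.card_pos.ne'
  unfold dens
  rw [Finset.sum_sub_distrib]
  field_simp
  simp

theorem sum_dens_mul_card (G : SimpleGraph V) {U Q : Finset V} (hQ : Q.Nonempty)
    (hU : U.Nonempty) :
    (∑ w ∈ U, dens G Q w) * Q.card = (∑ v ∈ Q, dens G U v) * U.card := by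
  rw [Finset.sum_mul, Finset.sum_mul, Finset.sum_congr rfl fun w _ => dens_mul_card G hQ w,
    Finset.sum_congr rfl fun w _ => dens_mul_card G hU w, Finset.sum_comm]
  exact Finset.sum_congr rfl fun _ _ => Finset.sum_congr rfl fun _ _ => adjInd_comm _ _ _

variable [Fintype V]

theorem sum_avg_mul_avg (φ ψ : V → V → ℝ) (P Q : Finset V) :
    ∑ w, ((∑ u ∈ P, φ w u) / P.card) * ((∑ v ∈ Q, ψ w v) / Q.card)
      = (∑ u ∈ P, ∑ v ∈ Q, ∑ w, φ w u * ψ w v) / (P.card * Q.card) := by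
  simp_rw [div_mul_div_comm, ← Finset.sum_div, Finset.sum_mul_sum]
  congr 1
  rw [Finset.sum_comm]
  exact Finset.sum_congr rfl fun _ _ => Finset.sum_comm

theorem sum_avg_mul_avg_le (φ : V → V → ℝ) {P Q : Finset V} (hP : P.Nonempty) (hQ : Q.Nonempty)
    {K : ℝ} (h : ∀ u ∈ P, ∀ v ∈ Q, ∑ w, φ w u * φ w v ≤ K) :
    ∑ w, ((∑ u ∈ P, φ w u) / P.card) * ((∑ v ∈ Q, φ w v) / Q.card) ≤ K := by
  have hP' : (0 : ℝ) < P.card := by exact_mod_cast hP.card_pos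
  have hQ' : (0 : ℝ) < Q.card := by exact_mod_cast hQ.card_pos
  rw [sum_avg_mul_avg, div_le_iff₀ (by positivity)]
  calc _ ≤ ∑ u ∈ P, ∑ v ∈ Q, K :=
        Finset.sum_le_sum fun u hu => Finset.sum_le_sum fun v hv => h u hu v hv
    _ = _ := by simp; ring

theorem sum_avg_sq_le (φ : V → V → ℝ) {Q : Finset V} (hQ : Q.Nonempty)
    {K N : ℝ} (hK : 0 ≤ K) (hN : ∀ u ∈ Q, ∑ w, φ w u * φ w u ≤ N)
    (h : ∀ u ∈ Q, ∀ v ∈ Q, u ≠ v → ∑ w, φ w u * φ w v ≤ K) :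
    ∑ w, ((∑ u ∈ Q, φ w u) / Q.card) ^ 2 ≤ K + N / Q.card := by
  have hQ' : (0 : ℝ) < Q.card := by exact_mod_cast hQ.card_pos
  simp_rw [sq]
  rw [sum_avg_mul_avg, div_le_iff₀ (by positivity)]
  calc _ ≤ ∑ u ∈ Q, ∑ v ∈ Q, (K + if u = v then N else 0) := by
        refine Finset.sum_le_sum fun u hu => Finset.sum_le_sum fun v hv => ?_
        split_ifs with huv
        · subst huv; linarith [hN u hu]
        · linarith [h u hu v hv huv]
    _ = Q.card * Q.card * K + Q.card * N := by
        simp [Finset.sum_add_distrib]; ring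
    _ = _ := by field_simp

/-- Upper bounds on codegrees, as fractions of the number of vertices: two adjacent vertices have
at most `ρ |V|` common neighbours, and two distinct nonadjacent vertices have at most `x |V|` common
non-neighbours. A vertex counts as its own non-neighbour. -/
structure CodegBounded (G : SimpleGraph V) (ρ x : ℝ) : Prop where
  adj : ∀ u v, G.Adj u v → ∑ w, adjInd G w u * adjInd G w v ≤ ρ * Fintype.card V
  nonadj : ∀ u v, u ≠ v → ¬ G.Adj u v →
    ∑ w, (1 - adjInd G w u) * (1 - adjInd G w v) ≤ x * Fintype.card V

theorem sum_mul_self_le_card {φ : V → V → ℝ} (h0 : ∀ u v, 0 ≤ φ u v) (h1 : ∀ u v, φ u v ≤ 1)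
    (u v : V) : ∑ w, φ w u * φ w v ≤ Fintype.card V := by
  calc ∑ w, φ w u * φ w v ≤ ∑ w : V, (1 : ℝ) :=
        Finset.sum_le_sum fun w _ => mul_le_one₀ (h1 _ _) (h0 _ _) (h1 _ _)
    _ = _ := by simp

variable {G : SimpleGraph V} {ρ x : ℝ}

namespace CodegBounded

theorem sum_dens_mul_dens_le (hG : CodegBounded G ρ x) {P Q : Finset V}
    (hP : P.Nonempty) (hQ : Q.Nonempty) (h : ∀ u ∈ P, ∀ v ∈ Q, G.Adj u v) :
    ∑ w, dens G P w * dens G Q w ≤ ρ * Fintype.card V :=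
  sum_avg_mul_avg_le _ hP hQ fun u hu v hv => hG.adj u v (h u hu v hv)

theorem sum_one_sub_dens_mul_le (hG : CodegBounded G ρ x) {P Q : Finset V}
    (hP : P.Nonempty) (hQ : Q.Nonempty) (h : ∀ u ∈ P, ∀ v ∈ Q, u ≠ v ∧ ¬ G.Adj u v) :
    ∑ w, (1 - dens G P w) * (1 - dens G Q w) ≤ x * Fintype.card V := by
  simp_rw [one_sub_dens G hP, one_sub_dens G hQ]
  exact sum_avg_mul_avg_le (fun w u => 1 - adjInd G w u) hP hQ
    fun u hu v hv => hG.nonadj u v (h u hu v hv).1 (h u hu v hv).2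

theorem sum_dens_sq_le (hG : CodegBounded G ρ x) (hρ : 0 ≤ ρ) {Q : Finset V} (hQ : Q.Nonempty)
    (h : G.IsClique Q) :
    ∑ w, dens G Q w ^ 2 ≤ ρ * Fintype.card V + Fintype.card V / Q.card :=
  sum_avg_sq_le _ hQ (by positivity)
    (fun u _ => sum_mul_self_le_card (adjInd_nonneg G) (adjInd_le_one G) u u)
    fun u hu v hv huv => hG.adj u v (h hu hv huv)

theorem sum_one_sub_dens_sq_le (hG : CodegBounded G ρ x) (hx : 0 ≤ x) {Q : Finset V}
    (hQ : Q.Nonempty) (h : Gᶜ.IsClique Q) :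
    ∑ w, (1 - dens G Q w) ^ 2 ≤ x * Fintype.card V + Fintype.card V / Q.card := by
  simp_rw [one_sub_dens G hQ]
  refine sum_avg_sq_le (fun w u => 1 - adjInd G w u) hQ (by positivity)
    (fun u _ => sum_mul_self_le_card (φ := fun w u => 1 - adjInd G w u)
      (fun w v => ?_) (fun w v => ?_) u u)
    fun u hu v hv huv => hG.nonadj u v huv (h hu hv huv).2
  · linarith [adjInd_le_one G w v]
  · linarith [adjInd_nonneg G w v]

/-- Two large cliques cannot be joined completely by non-edges. The reason is the inequality
`(1 - a) (1 - b) + a ^ 2 + b ^ 2 ≥ 2 / 3`, summed over the densities `a`, `b` of all vertices to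
the two cliques. -/
theorem not_two_cliques (hG : CodegBounded G ρ x) (hρ : 0 ≤ ρ) [Nonempty V] {t : ℕ} {ε : ℝ}
    (hε : 3 * x + 6 * ρ ≤ 2 - ε) (ht : 6 / (t : ℝ) < ε) (ht0 : 0 < t) {P Q : Finset V}
    (hP : t ≤ P.card) (hQ : t ≤ Q.card) (hPc : G.IsClique P) (hQc : G.IsClique Q)
    (h : ∀ u ∈ P, ∀ v ∈ Q, u ≠ v ∧ ¬ G.Adj u v) : False := by
  have hP0 : P.Nonempty := Finset.card_pos.mp (by omega)
  have hQ0 : Q.Nonempty := Finset.card_pos.mp (by omega)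
  have hN : (0 : ℝ) < Fintype.card V := by exact_mod_cast Fintype.card_pos
  have ht' : (0 : ℝ) < t := by exact_mod_cast ht0
  have b1 := hG.sum_dens_sq_le hρ hP0 hPc
  have b2 := hG.sum_dens_sq_le hρ hQ0 hQc
  have b3 := hG.sum_one_sub_dens_mul_le hP0 hQ0 h
  have c1 : (Fintype.card V : ℝ) / P.card ≤ Fintype.card V / t := by gcongr
  have c2 : (Fintype.card V : ℝ) / Q.card ≤ Fintype.card V / t := by gcongr
  have key : ∑ w : V, (2 / 3 : ℝ) ≤ ∑ w, ((1 - dens G P w) * (1 - dens G Q w)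
      + dens G P w ^ 2 + dens G Q w ^ 2) := by
    refine Finset.sum_le_sum fun w _ => ?_
    nlinarith [sq_nonneg (dens G P w - dens G Q w),
      sq_nonneg (dens G P w + dens G Q w - 2 / 3)]
  rw [Finset.sum_add_distrib, Finset.sum_add_distrib] at key
  simp only [Finset.sum_const, Finset.card_univ, nsmul_eq_mul] at key
  have : (6 / (t : ℝ)) * Fintype.card V < ε * Fintype.card V := by gcongr
  have e : (6 / (t : ℝ)) * Fintype.card V = 6 * (Fintype.card V / t) := by ring
  nlinarith

/-- Three large independent sets cannot be pairwise completely joined. With `s = a + b + c` the sum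
of the densities of a vertex to the three sets, the reason is
`(1 - a) ^ 2 + (1 - b) ^ 2 + (1 - c) ^ 2 + 2 (a b + b c + c a) = 3 - 2 s + s ^ 2 ≥ 2`. -/
theorem not_three_independent (hG : CodegBounded G ρ x) (hx : 0 ≤ x) [Nonempty V] {t : ℕ} {ε : ℝ}
    (hε : 3 * x + 6 * ρ ≤ 2 - ε) (ht : 6 / (t : ℝ) < ε) (ht0 : 0 < t) {P Q S : Finset V}
    (hP : t ≤ P.card) (hQ : t ≤ Q.card) (hS : t ≤ S.card)
    (hPc : Gᶜ.IsClique P) (hQc : Gᶜ.IsClique Q) (hSc : Gᶜ.IsClique S)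
    (hPQ : ∀ u ∈ P, ∀ v ∈ Q, G.Adj u v) (hQS : ∀ u ∈ Q, ∀ v ∈ S, G.Adj u v)
    (hPS : ∀ u ∈ P, ∀ v ∈ S, G.Adj u v) : False := by
  have hP0 : P.Nonempty := Finset.card_pos.mp (by omega)
  have hQ0 : Q.Nonempty := Finset.card_pos.mp (by omega)
  have hS0 : S.Nonempty := Finset.card_pos.mp (by omega)
  have hN : (0 : ℝ) < Fintype.card V := by exact_mod_cast Fintype.card_pos
  have ht' : (0 : ℝ) < t := by exact_mod_cast ht0
  have b1 := hG.sum_one_sub_dens_sq_le hx hP0 hPc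
  have b2 := hG.sum_one_sub_dens_sq_le hx hQ0 hQc
  have b3 := hG.sum_one_sub_dens_sq_le hx hS0 hSc
  have b4 := hG.sum_dens_mul_dens_le hP0 hQ0 hPQ
  have b5 := hG.sum_dens_mul_dens_le hQ0 hS0 hQS
  have b6 := hG.sum_dens_mul_dens_le hP0 hS0 hPS
  have c1 : (Fintype.card V : ℝ) / P.card ≤ Fintype.card V / t := by gcongr
  have c2 : (Fintype.card V : ℝ) / Q.card ≤ Fintype.card V / t := by gcongr
  have c3 : (Fintype.card V : ℝ) / S.card ≤ Fintype.card V / t := by gcongr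
  have key : ∑ w : V, (2 : ℝ) ≤ ∑ w, ((1 - dens G P w) ^ 2 + (1 - dens G Q w) ^ 2
      + (1 - dens G S w) ^ 2 + 2 * (dens G P w * dens G Q w) + 2 * (dens G Q w * dens G S w)
      + 2 * (dens G P w * dens G S w)) := by
    refine Finset.sum_le_sum fun w _ => ?_
    nlinarith [sq_nonneg (dens G P w + dens G Q w + dens G S w - 1)]
  simp only [Finset.sum_add_distrib, ← Finset.mul_sum] at key
  simp only [Finset.sum_const, Finset.card_univ, nsmul_eq_mul] at key
  have : (6 / (t : ℝ)) * Fintype.card V < ε * Fintype.card V := by gcongr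
  have e : (6 / (t : ℝ)) * Fintype.card V = 6 * (Fintype.card V / t) := by ring
  have : 0 < (Fintype.card V : ℝ) / t := by positivity
  nlinarith

end CodegBounded

end Density

/-! ### Pigeonhole on neighbourhood patterns -/

section Pattern

variable {V : Type*}

theorem exists_common_pattern (r : V → V → Prop) (Q W : Finset V) (k : ℕ)
    (h : 2 ^ Q.card * k ≤ W.card) :
    ∃ W' ⊆ W, k ≤ W'.card ∧ ∀ w ∈ W', ∀ w' ∈ W', ∀ v ∈ Q, r w v ↔ r w' v := by
  obtain ⟨S, -, hS⟩ := Finset.exists_le_card_fiber_of_mul_le_card_of_maps_to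
    (s := W) (t := Q.powerset) (f := fun w => Q.filter (r w)) (n := k)
    (fun w _ => Finset.mem_powerset.mpr (Finset.filter_subset _ _)) ⟨∅, by simp⟩
    (by rwa [Finset.card_powerset])
  refine ⟨_, Finset.filter_subset _ _, hS, fun w hw w' hw' v hv => ?_⟩
  have e : Q.filter (r w) = Q.filter (r w') :=
    (Finset.mem_filter.mp hw).2.trans (Finset.mem_filter.mp hw').2.symm
  have := congrArg (v ∈ ·) e
  simpa [hv] using this

/-- Vertices of large degree carry much of the density of a bipartite relation. -/
theorem card_filter_large_degree (r : V → V → Prop) (X Y : Finset V) {θ : ℝ} (hθ : 0 ≤ θ)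
    (hY : Y.Nonempty)
    (h : θ * (X.card * Y.card) ≤ ∑ x ∈ X, ((Y.filter (r x)).card : ℝ)) :
    θ / 2 * X.card ≤ ((X.filter fun x => θ / 2 * Y.card ≤ (Y.filter (r x)).card).card : ℝ) := by
  have hY' : (0 : ℝ) < Y.card := by exact_mod_cast hY.card_pos
  have h1 : ∑ x ∈ X, ((Y.filter (r x)).card : ℝ) ≤ ∑ x ∈ X,
      (θ / 2 * Y.card + if θ / 2 * Y.card ≤ (Y.filter (r x)).card then (Y.card : ℝ) else 0) := by
    refine Finset.sum_le_sum fun x _ => ?_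
    have : ((Y.filter (r x)).card : ℝ) ≤ Y.card := by
      exact_mod_cast Finset.card_le_card (Finset.filter_subset _ _)
    split_ifs with hx
    · have : 0 ≤ θ / 2 * Y.card := by positivity
      linarith
    · linarith
  rw [Finset.sum_add_distrib, ← Finset.sum_filter] at h1
  simp only [Finset.sum_const, nsmul_eq_mul] at h1
  have h2 : (θ / 2 * X.card) * Y.card ≤
      ((X.filter fun x => θ / 2 * Y.card ≤ (Y.filter (r x)).card).card : ℝ) * Y.card := by
    linarith
  exact le_of_mul_le_mul_right h2 hY'

/-- A Kővári–Sós–Turán statement: a dense bipartite relation between large sets contains a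
complete bipartite relation between sets of size `t`. -/
theorem exists_complete_bipartite (θ : ℝ) (hθ : 0 < θ) (t : ℕ) : ∃ T₀ : ℕ, ∀ {V : Type} (T : ℕ),
    T₀ ≤ T → ∀ (r : V → V → Prop), (∀ u v, r u v → r v u) → ∀ X Y : Finset V,
      X.card = T → Y.card = T → θ * (T * T : ℝ) ≤ ∑ x ∈ X, ((Y.filter (r x)).card : ℝ) →
      ∃ X' ⊆ X, ∃ Y' ⊆ Y, t ≤ X'.card ∧ t ≤ Y'.card ∧ ∀ x ∈ X', ∀ y ∈ Y', r x y := by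
  obtain ⟨s, hs⟩ := exists_nat_ge (4 * t / θ)
  obtain ⟨T₁, hT₁⟩ := exists_nat_ge (max (2 * s / θ) (4 * (2 ^ s * (t + 1)) / θ))
  have hT₁a : 2 * s / θ ≤ (T₁ : ℝ) := (le_max_left _ _).trans hT₁
  have hT₁b : 4 * (2 ^ s * (t + 1)) / θ ≤ (T₁ : ℝ) := (le_max_right _ _).trans hT₁
  rw [div_le_iff₀ hθ] at hs hT₁a hT₁b
  refine ⟨T₁ + 1, fun {V} T hT r hr X Y hX hY h => ?_⟩
  have hTr : (T₁ : ℝ) ≤ T := by exact_mod_cast (by omega : T₁ ≤ T)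
  have hY0 : Y.Nonempty := Finset.card_pos.mp (by omega)
  have h1 := card_filter_large_degree r X Y hθ.le hY0 (by rw [hX, hY]; exact h)
  rw [hX] at h1
  have hsX : s ≤ (X.filter fun x => θ / 2 * Y.card ≤ (Y.filter (r x)).card).card := by
    have : (s : ℝ) ≤ ((X.filter fun x => θ / 2 * Y.card ≤ (Y.filter (r x)).card).card : ℝ) := by
      nlinarith
    exact_mod_cast this
  obtain ⟨X₁, hX₁, hX₁c⟩ := Finset.exists_subset_card_eq hsX
  rcases Nat.eq_zero_or_pos t with rfl | ht
  · exact ⟨∅, by simp, ∅, by simp, by simp, by simp, by simp⟩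
  have hs0 : 0 < s := by
    rcases Nat.eq_zero_or_pos s with rfl | h
    · have : (0 : ℝ) < t := by exact_mod_cast ht
      norm_num at hs; linarith
    · exact h
  have hX₁0 : X₁.Nonempty := Finset.card_pos.mp (by omega)
  have hsum : θ / 2 * (Y.card * X₁.card) ≤ ∑ y ∈ Y, ((X₁.filter (r y)).card : ℝ) := by
    have e : ∑ y ∈ Y, ((X₁.filter (r y)).card : ℝ) = ∑ x ∈ X₁, ((Y.filter (r x)).card : ℝ) := by
      simp_rw [Finset.card_filter, Nat.cast_sum]
      rw [Finset.sum_comm]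
      refine Finset.sum_congr rfl fun x _ => Finset.sum_congr rfl fun y _ => ?_
      rw [show r y x ↔ r x y from ⟨hr _ _, hr _ _⟩]
    rw [e]
    calc θ / 2 * (Y.card * X₁.card) = ∑ x ∈ X₁, θ / 2 * Y.card := by simp; ring
      _ ≤ _ := Finset.sum_le_sum fun x hx => (Finset.mem_filter.mp (hX₁ hx)).2
  have h2 := card_filter_large_degree r Y X₁ (by positivity) hX₁0 hsum
  set Y₁ := Y.filter fun y => θ / 2 / 2 * X₁.card ≤ (X₁.filter (r y)).card with hY₁
  have hY₁c : 2 ^ X₁.card * (t + 1) ≤ Y₁.card := by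
    have : ((2 : ℝ) ^ X₁.card * (t + 1)) ≤ Y₁.card := by
      rw [hY] at h2
      rw [hX₁c]
      nlinarith
    exact_mod_cast this
  obtain ⟨Y', hY', hY'c, hpat⟩ := exists_common_pattern r X₁ Y₁ (t + 1) hY₁c
  obtain ⟨y₀, hy₀⟩ : Y'.Nonempty := Finset.card_pos.mp (by omega)
  refine ⟨X₁.filter (r y₀), (Finset.filter_subset _ _).trans
      (hX₁.trans (Finset.filter_subset _ _)), Y', hY'.trans (Finset.filter_subset _ _), ?_,
      by omega, fun x hx y hy => ?_⟩
  · have := (Finset.mem_filter.mp (hY' hy₀)).2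
    rw [hX₁c] at this
    have : (t : ℝ) ≤ ((X₁.filter (r y₀)).card : ℝ) := by nlinarith
    exact_mod_cast this
  · obtain ⟨hx1, hx2⟩ := Finset.mem_filter.mp hx
    exact hr _ _ ((hpat y₀ hy₀ y hy x hx1).mp hx2)

end Pattern

/-! ### Splitting off a nearly complete part -/

section Split

theorem exists_clique_packing {V : Type*} [Fintype V] (G : SimpleGraph V) (T : ℕ) :
    ∃ F : Finset (Finset V), (∀ Q ∈ F, G.IsNClique T Q) ∧
      (∀ Q ∈ F, ∀ Q' ∈ F, Q ≠ Q' → Disjoint Q Q') ∧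
      ∀ Q, G.IsNClique T Q → Disjoint Q (F.biUnion id) → Q ∈ F := by
  obtain ⟨F, hF, hmax⟩ := Finset.exists_max_image
    (Finset.univ.filter fun F : Finset (Finset V) => (∀ Q ∈ F, G.IsNClique T Q) ∧
      (∀ Q ∈ F, ∀ Q' ∈ F, Q ≠ Q' → Disjoint Q Q')) Finset.card ⟨∅, by simp⟩
  obtain ⟨h1, h2⟩ := (Finset.mem_filter.mp hF).2
  refine ⟨F, h1, h2, fun Q hQ hd => ?_⟩
  by_contra hQF
  have hd' : ∀ Q' ∈ F, Disjoint Q Q' := fun Q' hQ' =>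
    hd.mono_right (Finset.subset_biUnion_of_mem id hQ')
  have := hmax (insert Q F) (Finset.mem_filter.mpr ⟨Finset.mem_univ _, ?_, ?_⟩)
  · rw [Finset.card_insert_of_notMem hQF] at this
    omega
  · intro Q' hQ'
    rcases Finset.mem_insert.mp hQ' with rfl | h
    · exact hQ
    · exact h1 _ h
  · intro P hP P' hP' hne
    rcases Finset.mem_insert.mp hP with rfl | h <;> rcases Finset.mem_insert.mp hP' with rfl | h'
    · exact absurd rfl hne
    · exact hd' _ h'
    · exact (hd' _ h).symm
    · exact h2 _ h _ h' hne

/-- If few pairs of `U` are nonadjacent, then the codegree condition on adjacent pairs bounds the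
second moment of the densities to `U`; the vertices of `U` contribute about `|U|` to it. -/
theorem CodegBounded.card_add_sum_dens_sq_le {V : Type*} [Fintype V] {G : SimpleGraph V}
    {ρ x δ : ℝ} (hG : CodegBounded G ρ x) (hρ : 0 ≤ ρ) (hδ : 0 ≤ δ) (U : Finset V)
    (hU : ∑ u ∈ U, ((U.filter fun v => ¬ G.Adj u v).card : ℝ) ≤ δ * (U.card * U.card)) :
    U.card + ∑ w ∈ Uᶜ, dens G U w ^ 2 ≤ ρ * Fintype.card V + 3 * δ * Fintype.card V := by
  rcases U.eq_empty_or_nonempty with rfl | hU0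
  · simp only [dens, Finset.card_empty, Finset.sum_empty]
    simp
    positivity
  have hUc : (0 : ℝ) < U.card := by exact_mod_cast hU0.card_pos
  have hUN : (U.card : ℝ) ≤ Fintype.card V := by exact_mod_cast Finset.card_le_univ U
  have hN : (0 : ℝ) ≤ Fintype.card V := Nat.cast_nonneg _
  have htot : ∑ w, dens G U w ^ 2 ≤ ρ * Fintype.card V + δ * Fintype.card V := by
    simp_rw [sq, dens]
    rw [sum_avg_mul_avg, div_le_iff₀ (by positivity)]
    calc ∑ u ∈ U, ∑ v ∈ U, ∑ w, adjInd G w u * adjInd G w v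
        ≤ ∑ u ∈ U, ∑ v ∈ U, (ρ * Fintype.card V +
            if ¬ G.Adj u v then (Fintype.card V : ℝ) else 0) := by
          refine Finset.sum_le_sum fun u _ => Finset.sum_le_sum fun v _ => ?_
          have := sum_mul_self_le_card (adjInd_nonneg G) (adjInd_le_one G) u v
          split_ifs with h
          · linarith [hG.adj u v h]
          · have : 0 ≤ ρ * (Fintype.card V : ℝ) := by positivity
            linarith
      _ = U.card * U.card * (ρ * Fintype.card V) +
            (∑ u ∈ U, ((U.filter fun v => ¬ G.Adj u v).card : ℝ)) * Fintype.card V := by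
          simp only [Finset.sum_add_distrib, ← Finset.sum_filter, Finset.sum_const, nsmul_eq_mul,
            Finset.sum_mul]
          ring
      _ ≤ U.card * U.card * (ρ * Fintype.card V) +
            δ * (U.card * U.card) * Fintype.card V := by gcongr
      _ = _ := by ring
  have hin : (U.card : ℝ) - 2 * δ * U.card ≤ ∑ w ∈ U, dens G U w ^ 2 := by
    have h1 : ∑ w ∈ U, (1 - dens G U w) ≤ δ * U.card := by
      simp_rw [one_sub_dens G hU0, ← Finset.sum_div]
      rw [div_le_iff₀ hUc]
      refine le_trans (le_of_eq ?_) (hU.trans_eq (by ring))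
      refine Finset.sum_congr rfl fun u _ => ?_
      rw [Finset.card_filter, Nat.cast_sum]
      refine Finset.sum_congr rfl fun v _ => ?_
      unfold adjInd
      by_cases h : G.Adj u v <;> simp [h]
    have h2 : ∑ w ∈ U, (1 - 2 * (1 - dens G U w)) ≤ ∑ w ∈ U, dens G U w ^ 2 :=
      Finset.sum_le_sum fun w _ => by nlinarith [sq_nonneg (1 - dens G U w)]
    rw [Finset.sum_sub_distrib, ← Finset.mul_sum] at h2
    simp only [Finset.sum_const, nsmul_eq_mul] at h2
    linarith
  rw [← Finset.sum_add_sum_compl U] at htot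
  nlinarith

/-- Under the codegree conditions, the vertices split into a nearly complete set `U` and a set
without large cliques. The set `U` is the union of a maximal family of disjoint cliques of a large
fixed size; by `CodegBounded.not_two_cliques` few pairs between two of these are nonadjacent. -/
theorem exists_clique_part {ε δ : ℝ} (hε : 0 < ε) (hδ : 0 < δ) : ∃ T : ℕ,
    ∀ {V : Type} [Fintype V] [Nonempty V] (G : SimpleGraph V) (ρ x : ℝ), CodegBounded G ρ x →
      0 ≤ ρ → 3 * x + 6 * ρ ≤ 2 - ε →
      ∃ U : Finset V, (∀ Q ⊆ Uᶜ, ¬ G.IsNClique T Q) ∧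
        U.card + ∑ w ∈ Uᶜ, dens G U w ^ 2 ≤ ρ * Fintype.card V + 3 * δ * Fintype.card V := by
  obtain ⟨t, ht⟩ := exists_nat_gt (6 / ε)
  have ht0 : 0 < t := by
    have : (0 : ℝ) < t := lt_trans (by positivity) ht
    exact_mod_cast this
  have ht' : 6 / (t : ℝ) < ε := by
    rw [div_lt_iff₀ hε] at ht
    rw [div_lt_iff₀ (by exact_mod_cast ht0)]
    linarith
  obtain ⟨T₀, hT₀⟩ := exists_complete_bipartite δ hδ t
  obtain ⟨T₁, hT₁⟩ := exists_nat_ge (1 / δ)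
  obtain ⟨T, hT0, hT1, hTpos⟩ : ∃ T, T₀ ≤ T ∧ T₁ ≤ T ∧ 0 < T :=
    ⟨T₀ + T₁ + 1, by omega, by omega, by omega⟩
  refine ⟨T, fun {V} _ _ G ρ x hG hρ hx => ?_⟩
  obtain ⟨F, hF, hdisj, hmax⟩ := exists_clique_packing G T
  have hpair : ∀ Q ∈ F, ∀ Q' ∈ F,
      ∑ u ∈ Q, ((Q'.filter fun v => ¬ G.Adj u v).card : ℝ) ≤ δ * (T * T) := by
    intro Q hQ Q' hQ'
    by_cases hne : Q = Q'
    · subst hne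
      have : ∀ u ∈ Q, ((Q.filter fun v => ¬ G.Adj u v).card : ℝ) ≤ 1 := by
        intro u hu
        have : (Q.filter fun v => ¬ G.Adj u v) ⊆ {u} := by
          intro v hv
          obtain ⟨hv, hv'⟩ := Finset.mem_filter.mp hv
          by_contra h
          exact hv' ((hF Q hQ).isClique hu hv fun h' => h (by simp [h']))
        exact_mod_cast (Finset.card_le_card this).trans (by simp)
      refine (Finset.sum_le_sum this).trans ?_
      have h1 : (1 : ℝ) ≤ δ * T := by
        rw [div_le_iff₀ hδ] at hT₁
        have : (T₁ : ℝ) ≤ T := by exact_mod_cast hT1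
        nlinarith
      have h2 : (0 : ℝ) ≤ T := Nat.cast_nonneg _
      simp only [Finset.sum_const, nsmul_eq_mul, (hF Q hQ).card_eq]
      nlinarith
    · by_contra! hlt
      obtain ⟨X, hX, Y, hY, hXc, hYc, hXY⟩ := hT₀ T hT0 (fun u v => ¬ G.Adj u v)
        (fun u v h h' => h h'.symm) Q Q' (hF Q hQ).card_eq (hF Q' hQ').card_eq
        (hlt.le.trans_eq (Finset.sum_congr rfl fun u _ => by congr))
      exact hG.not_two_cliques hρ hx ht' ht0 hXc hYc ((hF Q hQ).isClique.subset hX)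
        ((hF Q' hQ').isClique.subset hY) fun u hu v hv =>
          ⟨fun h => Finset.disjoint_left.mp (hdisj Q hQ Q' hQ' hne) (hX hu) (h ▸ hY hv),
            hXY u hu v hv⟩
  have hdisj' : Set.PairwiseDisjoint (F : Set (Finset V)) (id : Finset V → Finset V) :=
    fun Q hQ Q' hQ' h => hdisj Q hQ Q' hQ' h
  have hcard : ((F.biUnion id).card : ℝ) = F.card * T := by
    rw [Finset.card_biUnion hdisj', Finset.sum_congr rfl fun Q hQ =>
      show (id Q).card = T from (hF Q hQ).card_eq]
    simp
  refine ⟨F.biUnion id, fun Q hQ hQc => ?_, hG.card_add_sum_dens_sq_le hρ hδ.le _ ?_⟩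
  · have hd : Disjoint Q (F.biUnion id) :=
      Finset.disjoint_left.mpr fun v hv => Finset.mem_compl.mp (hQ hv)
    have hmem := hmax Q hQc hd
    have hsub : Q ⊆ F.biUnion id := Finset.subset_biUnion_of_mem id hmem
    have : Q = ∅ := Finset.disjoint_self_iff_empty _ |>.mp (hd.mono_right hsub)
    have h0 := hQc.card_eq
    rw [this, Finset.card_empty] at h0
    omega
  · calc ∑ u ∈ F.biUnion id, (((F.biUnion id).filter fun v => ¬ G.Adj u v).card : ℝ)
        = ∑ Q ∈ F, ∑ Q' ∈ F, ∑ u ∈ Q, ((Q'.filter fun v => ¬ G.Adj u v).card : ℝ) := by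
          rw [Finset.sum_biUnion hdisj']
          refine Finset.sum_congr rfl fun Q _ => ?_
          rw [Finset.sum_comm]
          refine Finset.sum_congr rfl fun u _ => ?_
          simp_rw [Finset.card_filter, Nat.cast_sum]
          rw [Finset.sum_biUnion hdisj']
          rfl
      _ ≤ ∑ Q ∈ F, ∑ Q' ∈ F, δ * (T * T : ℝ) :=
          Finset.sum_le_sum fun Q hQ => Finset.sum_le_sum fun Q' hQ' => hpair Q hQ Q' hQ'
      _ = _ := by rw [hcard]; simp; ring

end Split

/-! ### The part without large cliques -/

section Sparse

variable {V : Type*} {G : SimpleGraph V} {ρ x : ℝ}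

/-- By Jensen's inequality: if all vertices of `Q` have density at most `E` to `U`, then the
densities from `U` to `Q` are at most `E` on average. -/
theorem card_mul_le_sum_one_sub_dens_sq {U Q : Finset V} (hQ : Q.Nonempty) {E : ℝ} (hE : E ≤ 1)
    (h : ∀ v ∈ Q, dens G U v ≤ E) :
    U.card * (1 - E) ^ 2 ≤ ∑ w ∈ U, (1 - dens G Q w) ^ 2 := by
  rcases U.eq_empty_or_nonempty with rfl | hU
  · simp
  have hQ' : (0 : ℝ) < Q.card := by exact_mod_cast hQ.card_pos
  have hU' : (0 : ℝ) < U.card := by exact_mod_cast hU.card_pos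
  have h1 : ∑ w ∈ U, dens G Q w ≤ U.card * E := by
    have h2 := sum_dens_mul_card G hQ hU
    have h3 : ∑ v ∈ Q, dens G U v ≤ Q.card * E := by
      simpa using Finset.sum_le_sum h
    refine le_of_mul_le_mul_right ?_ hQ'
    rw [h2]
    nlinarith
  -- the tangent of `d ↦ (1 - d) ^ 2` at `E`
  have h4 : ∑ w ∈ U, ((1 - E) ^ 2 + 2 * (1 - E) * (E - dens G Q w)) ≤
      ∑ w ∈ U, (1 - dens G Q w) ^ 2 :=
    Finset.sum_le_sum fun w _ => by nlinarith [sq_nonneg (E - dens G Q w)]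
  rw [Finset.sum_add_distrib, ← Finset.mul_sum, Finset.sum_sub_distrib] at h4
  simp only [Finset.sum_const, nsmul_eq_mul] at h4
  have : 0 ≤ 2 * (1 - E) * (U.card * E - ∑ w ∈ U, dens G Q w) :=
    mul_nonneg (by linarith) (by linarith)
  linarith

variable [Fintype V]

/-- Let `P` and `Q` be large independent sets that are completely joined to each other. By
`CodegBounded.not_three_independent`, if large subsets of `A` contain large independent sets then
few vertices of `A` have density at least `δ` to both `P` and `Q`. -/
theorem CodegBounded.card_common_lt (hG : CodegBounded G ρ x) (hx : 0 ≤ x) [Nonempty V]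
    {t s k : ℕ} {ε δ : ℝ} (hδ : 0 < δ) (hε : 3 * x + 6 * ρ ≤ 2 - ε) (ht : 6 / (t : ℝ) < ε)
    (ht0 : 0 < t) (hs : (t : ℝ) ≤ δ * s) {A : Finset V} (hk0 : 0 < k)
    (hk : ∀ W ⊆ A, k ≤ W.card → ∃ Q ⊆ W, Gᶜ.IsNClique t Q)
    {P Q : Finset V} (hP : s ≤ P.card) (hQ : s ≤ Q.card)
    (hPc : Gᶜ.IsClique P) (hQc : Gᶜ.IsClique Q) (hPQ : ∀ u ∈ P, ∀ v ∈ Q, G.Adj u v) :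
    (A.filter fun w => δ ≤ dens G P w ∧ δ ≤ dens G Q w).card < 2 ^ (P.card + Q.card) * k := by
  by_contra! hlt
  obtain ⟨W, hW, hWk, hpat⟩ := exists_common_pattern G.Adj (P ∪ Q) _ k
    ((Nat.mul_le_mul_right k (Nat.pow_le_pow_right two_pos (Finset.card_union_le P Q))).trans hlt)
  obtain ⟨w₀, hw₀⟩ : W.Nonempty := Finset.card_pos.mp (by omega)
  obtain ⟨S, hS, hSc⟩ := hk W (hW.trans (Finset.filter_subset _ _)) hWk
  have hlarge : ∀ R : Finset V, s ≤ R.card → δ ≤ dens G R w₀ →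
      t ≤ (R.filter fun v => G.Adj w₀ v).card := by
    intro R hR hd
    have hs0 : 0 < s := by
      rcases Nat.eq_zero_or_pos s with rfl | h
      · have : (0 : ℝ) < t := by exact_mod_cast ht0
        norm_num at hs; linarith
      · exact h
    have h1 := dens_mul_card G (Finset.card_pos.mp (by omega) : R.Nonempty) w₀
    rw [sum_adjInd] at h1
    have h2 : (s : ℝ) ≤ R.card := by exact_mod_cast hR
    have h3 : δ * R.card ≤ dens G R w₀ * R.card := by gcongr
    have : (t : ℝ) ≤ ((R.filter fun v => G.Adj w₀ v).card : ℝ) := by nlinarith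
    exact_mod_cast this
  obtain ⟨-, hw1, hw2⟩ := Finset.mem_filter.mp (hW hw₀)
  refine hG.not_three_independent hx hε ht ht0 (hlarge P hP hw1) (hlarge Q hQ hw2) hSc.card_eq.ge
    (hPc.subset (Finset.filter_subset _ _)) (hQc.subset (Finset.filter_subset _ _)) hSc.isClique
    (fun u hu v hv => hPQ u (Finset.mem_filter.mp hu).1 v (Finset.mem_filter.mp hv).1)
    (fun u hu v hv => ?_) (fun u hu v hv => ?_)
  all_goals
    obtain ⟨hu1, hu2⟩ := Finset.mem_filter.mp hu
    exact ((hpat w₀ hw₀ v (hS hv) u (by simp [hu1])).mp hu2).symm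

/-- Suppose that `Q` is an independent set and that the vertices of a large set `W` outside `U` have
density at least `δ` to `Q`. Then `Q` and `W` contain large independent sets that are
completely joined to each other. Adding up the codegree conditions for these two sets, the vertices
outside `U` contribute at least about `1` each, by
`(1 - a) ^ 2 + (1 - b) ^ 2 = 1 + (a + b - 1) ^ 2 - 2 a b`. -/
theorem CodegBounded.card_add_le_of_dens_ge (hG : CodegBounded G ρ x) (hx : 0 ≤ x) [Nonempty V]
    {t s₁ s k₁ k₂ : ℕ} {ε δ : ℝ} (hδ : 0 < δ) (hε : 3 * x + 6 * ρ ≤ 2 - ε)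
    (ht : 6 / (t : ℝ) < ε) (ht0 : 0 < t) (hs₁ : (t : ℝ) ≤ δ * s₁) (hs : (s₁ : ℝ) ≤ δ * s)
    (hs₁' : 1 ≤ δ * s₁) {U : Finset V} (hk₁0 : 0 < k₁) (hk₂0 : 0 < k₂)
    (hk₁ : ∀ W ⊆ Uᶜ, k₁ ≤ W.card → ∃ Q ⊆ W, Gᶜ.IsNClique t Q)
    (hk₂ : ∀ W ⊆ Uᶜ, k₂ ≤ W.card → ∃ Q ⊆ W, Gᶜ.IsNClique s₁ Q)
    (hN : (2 ^ (s + s₁) * k₁ : ℝ) ≤ δ * Fintype.card V)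
    {Q W : Finset V} (hQ : Gᶜ.IsNClique s Q) (hWU : W ⊆ Uᶜ) (hW : 2 ^ s * k₂ ≤ W.card)
    (hWQ : ∀ w ∈ W, δ ≤ dens G Q w) {E₁ E₂ : ℝ} (hE₁ : E₁ ≤ 1) (hE₂ : E₂ ≤ 1)
    (hQE : ∀ v ∈ Q, dens G U v ≤ E₁) (hWE : ∀ v ∈ W, dens G U v ≤ E₂) :
    (Uᶜ.card : ℝ) + U.card * ((1 - E₁) ^ 2 + (1 - E₂) ^ 2) ≤
      2 * x * Fintype.card V + 6 * δ * Fintype.card V := by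
  have hs₁0 : 0 < s₁ := by
    rcases Nat.eq_zero_or_pos s₁ with rfl | h
    · norm_num at hs₁'
    · exact h
  have hs₁r : (0 : ℝ) < s₁ := by exact_mod_cast hs₁0
  have hs0 : 0 < s := by
    rcases Nat.eq_zero_or_pos s with rfl | h
    · norm_num at hs; omega
    · exact h
  obtain ⟨W', hW', hW'k, hpat⟩ := exists_common_pattern G.Adj Q W k₂ (by rwa [hQ.card_eq])
  obtain ⟨w₀, hw₀⟩ : W'.Nonempty := Finset.card_pos.mp (by omega)
  obtain ⟨P, hP, hPc⟩ := hk₂ W' (hW'.trans hWU) hW'k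
  set Q₁ := Q.filter fun v => G.Adj w₀ v with hQ₁
  have hQ₁s : s₁ ≤ Q₁.card := by
    have h1 := dens_mul_card G (Finset.card_pos.mp (by rw [hQ.card_eq]; omega) : Q.Nonempty) w₀
    rw [sum_adjInd, hQ.card_eq] at h1
    have h2 : δ * s ≤ dens G Q w₀ * s := by gcongr; exact hWQ _ (hW' hw₀)
    have : (s₁ : ℝ) ≤ (Q₁.card : ℝ) := by linarith
    exact_mod_cast this
  have hQ₁c : Gᶜ.IsClique Q₁ := hQ.isClique.subset (Finset.filter_subset _ _)
  have hQP : ∀ u ∈ Q₁, ∀ v ∈ P, G.Adj u v := fun u hu v hv => by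
    obtain ⟨hu1, hu2⟩ := Finset.mem_filter.mp hu
    exact ((hpat w₀ hw₀ v (hP hv) u hu1).mp hu2).symm
  have hcommon := hG.card_common_lt hx hδ hε ht ht0 hs₁ hk₁0 hk₁ hQ₁s hPc.card_eq.ge hQ₁c
    hPc.isClique hQP
  set Z := Uᶜ.filter fun w => δ ≤ dens G Q₁ w ∧ δ ≤ dens G P w with hZ
  have hZN : (Z.card : ℝ) ≤ δ * Fintype.card V := by
    refine le_trans ?_ hN
    have : Z.card ≤ 2 ^ (s + s₁) * k₁ := by
      refine hcommon.le.trans (Nat.mul_le_mul_right _ (Nat.pow_le_pow_right two_pos ?_))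
      have : Q₁.card ≤ Q.card := Finset.card_le_card (Finset.filter_subset _ _)
      rw [hQ.card_eq] at this
      rw [hPc.card_eq]
      omega
    exact_mod_cast this
  have hQ₁0 : Q₁.Nonempty := Finset.card_pos.mp (by omega)
  have hP0 : P.Nonempty := Finset.card_pos.mp (by rw [hPc.card_eq]; omega)
  have b1 := hG.sum_one_sub_dens_sq_le hx hQ₁0 hQ₁c
  have b2 := hG.sum_one_sub_dens_sq_le hx hP0 hPc.isClique
  have small : ∀ R : Finset V, s₁ ≤ R.card →
      (Fintype.card V : ℝ) / R.card ≤ δ * Fintype.card V := by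
    intro R hR
    have hR' : (s₁ : ℝ) ≤ R.card := by exact_mod_cast hR
    rw [div_le_iff₀ (by linarith)]
    have : (0 : ℝ) ≤ Fintype.card V := Nat.cast_nonneg _
    nlinarith [mul_le_mul_of_nonneg_left hR' hδ.le]
  have c1 := small Q₁ hQ₁s
  have c2 := small P hPc.card_eq.ge
  rw [← Finset.sum_add_sum_compl U] at b1 b2
  have j1 := card_mul_le_sum_one_sub_dens_sq (G := G) (U := U) hQ₁0 hE₁
    fun v hv => hQE v (Finset.filter_subset _ _ hv)
  have j2 := card_mul_le_sum_one_sub_dens_sq (G := G) (U := U) hP0 hE₂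
    fun v hv => hWE v (hW' (hP hv))
  have key : ∑ w ∈ Uᶜ, ((1 - 2 * δ) - if w ∈ Z then (2 : ℝ) else 0) ≤
      ∑ w ∈ Uᶜ, ((1 - dens G Q₁ w) ^ 2 + (1 - dens G P w) ^ 2) := by
    refine Finset.sum_le_sum fun w hw => ?_
    have p1 := dens_nonneg G Q₁ w
    have p2 := dens_nonneg G P w
    have p3 := dens_le_one G Q₁ w
    have p4 := dens_le_one G P w
    split_ifs with hwZ
    · nlinarith [sq_nonneg (1 - dens G Q₁ w), sq_nonneg (1 - dens G P w)]
    · have hab : dens G Q₁ w * dens G P w ≤ δ := by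
        have : ¬ (δ ≤ dens G Q₁ w ∧ δ ≤ dens G P w) := fun h =>
          hwZ (Finset.mem_filter.mpr ⟨hw, h⟩)
        rw [not_and_or, not_le, not_le] at this
        rcases this with h | h <;> nlinarith
      nlinarith [sq_nonneg (dens G Q₁ w + dens G P w - 1)]
  have hZsum : ∑ w ∈ Uᶜ, (if w ∈ Z then (2 : ℝ) else 0) = 2 * Z.card := by
    rw [Finset.sum_ite_mem, Finset.inter_eq_right.mpr (Finset.filter_subset _ _),
      Finset.sum_const, nsmul_eq_mul, mul_comm]
  rw [Finset.sum_sub_distrib, hZsum, Finset.sum_add_distrib] at key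
  simp only [Finset.sum_const, nsmul_eq_mul] at key
  have hA : (Uᶜ.card : ℝ) ≤ Fintype.card V := by exact_mod_cast Finset.card_le_univ _
  nlinarith

end Sparse

/-! ### Impossibility of the codegree conditions -/

section Impossible

/-- The `b`-th smallest value of `e` on `A`: at least `b` values are at most this one, and fewer
than `b` are smaller. -/
theorem exists_threshold {V : Type*} (A : Finset V) (e : V → ℝ) {b : ℕ} (hb : 0 < b)
    (hA : b ≤ A.card) : ∃ v₀ ∈ A, b ≤ (A.filter fun w => e w ≤ e v₀).card ∧
      (A.filter fun w => e w < e v₀).card < b := by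
  obtain ⟨m, hm, hmax⟩ := Finset.exists_max_image A e (Finset.card_pos.mp (by omega))
  obtain ⟨v₀, hv₀, hmin⟩ := Finset.exists_min_image
    (A.filter fun v => b ≤ (A.filter fun w => e w ≤ e v).card) e
    ⟨m, Finset.mem_filter.mpr ⟨hm, by rwa [Finset.filter_true_of_mem hmax]⟩⟩
  obtain ⟨hv₀A, hv₀b⟩ := Finset.mem_filter.mp hv₀
  refine ⟨v₀, hv₀A, hv₀b, ?_⟩
  by_contra! hlt
  obtain ⟨v₁, hv₁, hmax₁⟩ := Finset.exists_max_image (A.filter fun w => e w < e v₀) e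
    (Finset.card_pos.mp (by omega))
  obtain ⟨hv₁A, hv₁lt⟩ := Finset.mem_filter.mp hv₁
  refine absurd hv₁lt (not_lt.mpr (hmin v₁ (Finset.mem_filter.mpr ⟨hv₁A, hlt.trans ?_⟩)))
  refine Finset.card_le_card fun w hw => ?_
  exact Finset.mem_filter.mpr ⟨(Finset.mem_filter.mp hw).1, hmax₁ w hw⟩

/-- The points of the unit disc around `(1, 1)` have distance at least `√2 - 1` from the origin, and
`(√2 - 1) ^ 2 = 0.17157…`. -/
theorem sq_add_sq_ge_of_mem_disc {a b : ℝ} (h : (1 - a) ^ 2 + (1 - b) ^ 2 < 1) :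
    0.1715 ≤ a ^ 2 + b ^ 2 := by
  have h1 : (1 - a) + (1 - b) < 1.4143 := by
    refine lt_of_pow_lt_pow_left₀ 2 (by norm_num) ?_
    nlinarith [sq_nonneg ((1 - a) - (1 - b))]
  nlinarith [sq_nonneg (a - b)]

/-- An independent set `Q` whose vertices have density at most `E` to `U` has density at
least `δ` from many vertices outside `U`: the other ones contribute about `1` each to the codegree
condition for `Q`. -/
theorem CodegBounded.card_compl_add_le {V : Type*} [Fintype V] {G : SimpleGraph V} {ρ x : ℝ}
    (hG : CodegBounded G ρ x) (hx : 0 ≤ x) {U Q : Finset V} (hQ0 : Q.Nonempty)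
    (hQc : Gᶜ.IsClique Q) {E δ : ℝ} (hδ : 0 ≤ δ) (hE : E ≤ 1) (hQE : ∀ v ∈ Q, dens G U v ≤ E) :
    (Uᶜ.card : ℝ) + U.card * (1 - E) ^ 2 ≤ (Uᶜ.filter fun w => δ ≤ dens G Q w).card +
      x * Fintype.card V + Fintype.card V / Q.card + 2 * (δ * Fintype.card V) := by
  set M := Uᶜ.filter fun w => δ ≤ dens G Q w with hM
  have h1 := hG.sum_one_sub_dens_sq_le hx hQ0 hQc
  rw [← Finset.sum_add_sum_compl U] at h1
  have h2 := card_mul_le_sum_one_sub_dens_sq (G := G) (U := U) hQ0 hE hQE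
  have h3 : ∑ w ∈ Uᶜ, ((1 - 2 * δ) - if w ∈ M then (1 : ℝ) else 0) ≤
      ∑ w ∈ Uᶜ, (1 - dens G Q w) ^ 2 := by
    refine Finset.sum_le_sum fun w hw => ?_
    split_ifs with hwM
    · linarith [sq_nonneg (1 - dens G Q w)]
    · have : dens G Q w < δ := by
        by_contra! h
        exact hwM (Finset.mem_filter.mpr ⟨hw, h⟩)
      nlinarith only [sq_nonneg (dens G Q w), this]
  rw [Finset.sum_sub_distrib, Finset.sum_ite_mem,
    Finset.inter_eq_right.mpr (Finset.filter_subset _ _)] at h3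
  simp only [Finset.sum_const, nsmul_eq_mul, mul_one] at h3
  have h5 : δ * (Uᶜ.card : ℝ) ≤ δ * Fintype.card V := by
    gcongr
    exact Finset.card_le_univ _
  linarith

/-- If at least half of the values `e w` lie in the set `M`, and nearly all values `a = e w` with
`w ∈ M` satisfy `(1 - E) ^ 2 + (1 - a) ^ 2 < 1`, where `E` is almost the minimum of `e`, then the
mean square of `e` is at least about `(√2 - 1) ^ 2 / 2`. -/
theorem mul_card_sub_le_sum_sq {V : Type*} {A M : Finset V} {e : V → ℝ} {E : ℝ} (hMA : M ⊆ A)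
    (hE : 0 ≤ E) (hM : E ^ 2 < 0.08575 → (A.card : ℝ) / 2 ≤ M.card) :
    0.08575 * A.card - (A.filter fun w => e w < E).card -
      (M.filter fun w => 1 ≤ (1 - E) ^ 2 + (1 - e w) ^ 2).card ≤ ∑ w ∈ A, e w ^ 2 := by
  set L := A.filter fun w => e w < E with hL
  set M' := M.filter fun w => 1 ≤ (1 - E) ^ 2 + (1 - e w) ^ 2 with hM'
  have hsumL : ∑ w ∈ A, (if w ∈ L then (1 : ℝ) else 0) = L.card := by
    rw [Finset.sum_ite_mem, Finset.inter_eq_right.mpr (Finset.filter_subset _ _),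
      Finset.sum_const, nsmul_eq_mul, mul_one]
  by_cases hcase : 0.08575 ≤ E ^ 2
  · have h1 : ∑ w ∈ A, (0.08575 - if w ∈ L then (1 : ℝ) else 0) ≤ ∑ w ∈ A, e w ^ 2 := by
      refine Finset.sum_le_sum fun w hw => ?_
      split_ifs with hwL
      · linarith [sq_nonneg (e w)]
      · have : E ≤ e w := by
          by_contra! h
          exact hwL (Finset.mem_filter.mpr ⟨hw, h⟩)
        have : E ^ 2 ≤ e w ^ 2 := by gcongr
        linarith
    rw [Finset.sum_sub_distrib, hsumL] at h1
    simp only [Finset.sum_const, nsmul_eq_mul] at h1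
    linarith [(Nat.cast_nonneg M'.card : (0 : ℝ) ≤ M'.card)]
  · push Not at hcase
    have h1 : ∑ w ∈ A, (E ^ 2 + (if w ∈ M then (0.1715 - 2 * E ^ 2) else 0)
        - (if w ∈ L then (1 : ℝ) else 0) - (if w ∈ M' then (1 : ℝ) else 0))
        ≤ ∑ w ∈ A, e w ^ 2 := by
      refine Finset.sum_le_sum fun w hw => ?_
      have q := sq_nonneg (e w)
      have qE := sq_nonneg E
      by_cases hwL : w ∈ L
      · rw [if_pos hwL]
        split_ifs <;> linarith
      · have hle : E ≤ e w := by
          by_contra! h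
          exact hwL (Finset.mem_filter.mpr ⟨hw, h⟩)
        have hle2 : E ^ 2 ≤ e w ^ 2 := by gcongr
        rw [if_neg hwL]
        by_cases hwM' : w ∈ M'
        · rw [if_pos hwM']
          split_ifs <;> linarith
        · rw [if_neg hwM']
          split_ifs with hwM
          · have : (1 - E) ^ 2 + (1 - e w) ^ 2 < 1 := by
              by_contra! h
              exact hwM' (Finset.mem_filter.mpr ⟨hwM, h⟩)
            linarith [sq_add_sq_ge_of_mem_disc this]
          · linarith
    rw [Finset.sum_sub_distrib, Finset.sum_sub_distrib, Finset.sum_add_distrib, hsumL,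
      Finset.sum_ite_mem, Finset.sum_ite_mem, Finset.inter_eq_right.mpr hMA,
      Finset.inter_eq_right.mpr ((Finset.filter_subset _ _).trans hMA)] at h1
    simp only [Finset.sum_const, nsmul_eq_mul, mul_one] at h1
    have := mul_le_mul_of_nonneg_right (hM hcase) (by linarith : 0 ≤ 0.1715 - 2 * E ^ 2)
    linarith

/-- A graph with many vertices cannot satisfy the codegree conditions with `3 x + 6 ρ < 2` and
`x < 1 / 2`, both by a fixed margin. -/
theorem exists_forall_not_codegBounded {ε : ℝ} (hε : 0 < ε) : ∃ N₀ : ℕ,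
    ∀ {V : Type} [Fintype V] (G : SimpleGraph V) (ρ x : ℝ), N₀ ≤ Fintype.card V → 0 ≤ ρ → 0 ≤ x →
      3 * x + 6 * ρ ≤ 2 - ε → x ≤ 1 / 2 - ε → ¬ CodegBounded G ρ x := by
  obtain ⟨δ, hδ, hδε, hδc⟩ : ∃ δ : ℝ, 0 < δ ∧ 10 * δ ≤ ε ∧ δ ≤ 1 / 10000 :=
    ⟨min (ε / 10) (1 / 10000), by positivity, by linarith [min_le_left (ε / 10) (1 / 10000)],
      min_le_right _ _⟩
  obtain ⟨T, hT⟩ := exists_clique_part hε hδ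
  obtain ⟨t, ht⟩ := exists_nat_gt (6 / ε)
  have ht0 : 0 < t := by
    have : (0 : ℝ) < t := lt_trans (by positivity) ht
    exact_mod_cast this
  have ht' : 6 / (t : ℝ) < ε := by
    rw [div_lt_iff₀ hε] at ht
    rw [div_lt_iff₀ (by exact_mod_cast ht0)]
    linarith
  have ht1 : (1 : ℝ) ≤ t := by exact_mod_cast ht0
  obtain ⟨s₁, hs₁⟩ := exists_nat_ge (t / δ)
  rw [div_le_iff₀' hδ] at hs₁
  have hs₁1 : (1 : ℝ) ≤ s₁ := by nlinarith
  obtain ⟨s, hs⟩ := exists_nat_ge (s₁ / δ)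
  rw [div_le_iff₀' hδ] at hs
  have hs1 : (1 : ℝ) ≤ s := by nlinarith
  obtain ⟨k₁, hk₁⟩ := exists_clique_or_compl_clique T t
  obtain ⟨k₂, hk₂⟩ := exists_clique_or_compl_clique T s₁
  obtain ⟨b, hb⟩ := exists_clique_or_compl_clique T s
  obtain ⟨N₀, hN₀⟩ := exists_nat_ge
    ((2 ^ (s + s₁) * (k₁ + 1 : ℕ) + 2 ^ s * (k₂ + 1 : ℕ) + (b + 1 : ℕ) : ℝ) / δ)
  rw [div_le_iff₀' hδ] at hN₀
  refine ⟨N₀ + 1, fun {V} _ G ρ x hNV hρ hx hxρ hx2 hG => ?_⟩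
  have : Nonempty V := Fintype.card_pos_iff.mp (by omega)
  set N : ℝ := (Fintype.card V : ℝ) with hN
  have hNpos : 0 < N := by rw [hN]; exact_mod_cast Fintype.card_pos
  have hNN : (N₀ : ℝ) ≤ N := by rw [hN]; exact_mod_cast (by omega : N₀ ≤ Fintype.card V)
  have hδN : δ * N₀ ≤ δ * N := by gcongr
  have p1 : (0 : ℝ) ≤ 2 ^ (s + s₁) * (k₁ + 1 : ℕ) := by positivity
  have p2 : (0 : ℝ) ≤ 2 ^ s * (k₂ + 1 : ℕ) := by positivity
  have p3 : (0 : ℝ) ≤ (b + 1 : ℕ) := by positivity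
  obtain ⟨U, hU, hUS⟩ := hT G ρ x hG hρ hxρ
  rw [← hN] at hUS
  have ramsey : ∀ {m r : ℕ}, (∀ (V : Type) (R : SimpleGraph V) (s : Finset V), r ≤ s.card →
      (∃ t, t ⊆ s ∧ R.IsNClique T t) ∨ (∃ t, t ⊆ s ∧ Rᶜ.IsNClique m t)) →
      ∀ W ⊆ Uᶜ, r + 1 ≤ W.card → ∃ Q ⊆ W, Gᶜ.IsNClique m Q := by
    intro m r h W hW hWr
    rcases h V G W (by omega) with ⟨Q, hQ, hQc⟩ | ⟨Q, hQ, hQc⟩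
    · exact absurd hQc (hU Q (hQ.trans hW))
    · exact ⟨Q, hQ, hQc⟩
  have hAU : (Uᶜ.card : ℝ) + U.card = N := by
    rw [hN]; exact_mod_cast Finset.card_compl_add_card U
  set e : V → ℝ := dens G U with he
  have hS0 : 0 ≤ ∑ w ∈ Uᶜ, e w ^ 2 := Finset.sum_nonneg fun w _ => sq_nonneg _
  have hρN : 3 * (x * N) + 6 * (ρ * N) ≤ (2 - ε) * N := by
    nlinarith only [hxρ, hNpos]
  have hxN : x * N ≤ (1 / 2 - ε) * N := by gcongr
  have hxN0 : 0 ≤ x * N := by positivity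
  have hδN0 : 0 < δ * N := by positivity
  have hδNc : δ * N ≤ 1 / 10000 * N := by gcongr
  have hεN : 10 * (δ * N) ≤ ε * N := by
    nlinarith only [hδε, hNpos]
  have hbA : b + 1 ≤ Uᶜ.card := by
    have : ((b + 1 : ℕ) : ℝ) ≤ Uᶜ.card := by linarith
    exact_mod_cast this
  -- `Q` is an independent set on which the densities to `U` are nearly minimal
  obtain ⟨v₀, hv₀, hlow, hlow'⟩ := exists_threshold Uᶜ e (Nat.succ_pos b) hbA
  obtain ⟨Q, hQ, hQc⟩ := ramsey hb _ (Finset.filter_subset _ _) hlow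
  set E := e v₀ with hE
  have hE0 : 0 ≤ E := dens_nonneg _ _ _
  have hE1 : E ≤ 1 := dens_le_one _ _ _
  have hQE : ∀ v ∈ Q, dens G U v ≤ E := fun v hv => (Finset.mem_filter.mp (hQ hv)).2
  have hQ0 : Q.Nonempty := Finset.card_pos.mp (by
    rw [hQc.card_eq]
    have : (0 : ℝ) < s := by linarith
    exact_mod_cast this)
  set M := Uᶜ.filter fun w => δ ≤ dens G Q w with hM
  have hMcard : (Uᶜ.card : ℝ) + U.card * (1 - E) ^ 2 ≤ M.card + x * N + 3 * (δ * N) := by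
    have h1 := hG.card_compl_add_le hx hQ0 hQc.isClique hδ.le hE1 hQE
    rw [← hN, hQc.card_eq] at h1
    have h2 : N / s ≤ δ * N := by
      rw [div_le_iff₀ (by linarith)]
      nlinarith only [hs, hs₁1, hNpos]
    linarith
  have hpair : ∀ W ⊆ M, δ * N ≤ W.card → ∀ E₂ ≤ 1, (∀ v ∈ W, dens G U v ≤ E₂) →
      (Uᶜ.card : ℝ) + U.card * ((1 - E) ^ 2 + (1 - E₂) ^ 2) ≤ 2 * x * N + 6 * δ * N := by
    intro W hW hWc E₂ hE₂ hWE
    refine hG.card_add_le_of_dens_ge hx hδ hxρ ht' ht0 hs₁ hs (by linarith) (Nat.succ_pos k₁)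
      (Nat.succ_pos k₂) (ramsey hk₁) (ramsey hk₂) (by rw [← hN]; linarith) hQc
      (hW.trans (Finset.filter_subset _ _)) ?_ (fun w hw => (Finset.mem_filter.mp (hW hw)).2)
      hE1 hE₂ hQE hWE
    have : (2 ^ s * (k₂ + 1 : ℕ) : ℝ) ≤ W.card := by linarith
    exact_mod_cast this
  have hU0 : (0 : ℝ) ≤ U.card := Nat.cast_nonneg _
  have hUE : 0 ≤ U.card * (1 - E) ^ 2 := by positivity
  have hA2 : (Uᶜ.card : ℝ) ≤ 2 * (x * N) + 6 * (δ * N) := by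
    have := hpair M subset_rfl (by linarith) 1 le_rfl fun v _ => dens_le_one _ _ _
    nlinarith only [this, hU0, hUE]
  -- few vertices of `M` have a small density to `U`
  set M' := M.filter fun w => 1 ≤ (1 - E) ^ 2 + (1 - e w) ^ 2 with hM'
  have hM'card : (M'.card : ℝ) < δ * N := by
    by_contra! hlt
    have hne : M'.Nonempty := by
      refine Finset.card_pos.mp ?_
      have : (0 : ℝ) < M'.card := by linarith
      exact_mod_cast this
    obtain ⟨w, hw, hmax⟩ := Finset.exists_max_image M' e hne
    have h1 := hpair M' (Finset.filter_subset _ _) hlt (e w) (dens_le_one _ _ _) hmax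
    have h2 : U.card * 1 ≤ U.card * ((1 - E) ^ 2 + (1 - e w) ^ 2) := by
      gcongr
      exact (Finset.mem_filter.mp hw).2
    linarith
  have hS := mul_card_sub_le_sum_sq (A := Uᶜ) (M := M) (e := e) (Finset.filter_subset _ _) hE0
    fun hcase => by
      have hE3 : E < 0.29285 := lt_of_pow_lt_pow_left₀ 2 (by norm_num) (by linarith)
      have hE4 : 1 / 2 ≤ (1 - E) ^ 2 := by nlinarith only [hE3]
      have : U.card * (1 / 2) ≤ U.card * (1 - E) ^ 2 := by gcongr
      linarith
  have hLcard : ((Uᶜ.filter fun w => e w < E).card : ℝ) ≤ δ * N := by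
    have : (((Uᶜ.filter fun w => e w < E).card : ℕ) : ℝ) ≤ (b + 1 : ℕ) := by
      exact_mod_cast hlow'.le
    linarith
  -- `0.08575 > 1 / 12` gives the contradiction
  linarith

end Impossible

/-! ### Books and codegrees -/

section Books

/-- The number of common neighbours of two vertices. -/
noncomputable def codeg {V : Type*} [Fintype V] (G : SimpleGraph V) (u v : V) : ℕ :=
  (Finset.univ.filter fun w => G.Adj w u ∧ G.Adj w v).card

theorem codeg_le_card {V : Type*} [Fintype V] {G : SimpleGraph V} {u v : V} (S : Finset V)
    (h : ∀ w, G.Adj w u → G.Adj w v → w ∈ S) : codeg G u v ≤ S.card :=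
  Finset.card_le_card fun w hw => by
    obtain ⟨-, h1, h2⟩ := Finset.mem_filter.mp hw
    exact h w h1 h2

theorem book_isContained {V : Type*} [Fintype V] (R : SimpleGraph V) {u v : V} (huv : R.Adj u v)
    {m : ℕ} (hm : m ≤ codeg R u v) :
    (book m).IsContained R := by
  obtain ⟨t, ht, htc⟩ := Finset.exists_subset_card_eq hm
  have e : Fin m ≃ t := (Finset.equivFinOfCardEq htc).symm
  have he : ∀ i, R.Adj (e i) u ∧ R.Adj (e i) v := fun i => (Finset.mem_filter.mp (ht (e i).2)).2
  have hs : ∀ (i : Fin 2) (j : Fin m), R.Adj (e j) (![u, v] i) := by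
    intro i j
    fin_cases i
    · exact (he j).1
    · exact (he j).2
  have hinj : Function.Injective (Sum.elim ![u, v] fun i => (e i : V)) := by
    refine Function.Injective.sumElim ?_ (fun i j h => e.injective (Subtype.ext h))
      fun i j h => (hs i j).ne h.symm
    intro i j h
    fin_cases i <;> fin_cases j <;> simp [huv.ne, huv.ne'] at h ⊢
  refine ⟨⟨⟨Sum.elim ![u, v] fun i => (e i : V), ?_⟩, hinj⟩⟩
  rintro (i | i) (j | j) ⟨hne, hl⟩
  · fin_cases i <;> fin_cases j
    · exact absurd rfl hne
    · exact huv
    · exact huv.symm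
    · exact absurd rfl hne
  · exact (hs i j).symm
  · exact hs j i
  · simp at hl

theorem exists_adj_of_book_isContained {V : Type*} [Fintype V] {R : SimpleGraph V} {m : ℕ}
    (h : (book m).IsContained R) :
    ∃ u v, R.Adj u v ∧ m ≤ codeg R u v := by
  obtain ⟨f, hf⟩ := h
  refine ⟨f (Sum.inl 0), f (Sum.inl 1), f.map_adj ⟨by simp, by simp⟩, ?_⟩
  have hcard : (Finset.univ.image fun i : Fin m => f (Sum.inr i)).card = m := by
    rw [Finset.card_image_of_injective _ fun i j hij => Sum.inr_injective (hf hij)]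
    simp
  refine hcard.ge.trans (Finset.card_le_card fun w hw => ?_)
  obtain ⟨i, -, rfl⟩ := Finset.mem_image.mp hw
  exact Finset.mem_filter.mpr ⟨Finset.mem_univ _, f.map_adj ⟨by simp, by simp⟩,
    f.map_adj ⟨by simp, by simp⟩⟩

theorem sum_adjInd_mul_adjInd {V : Type*} [Fintype V] (G : SimpleGraph V) (u v : V) :
    ∑ w, adjInd G w u * adjInd G w v =
      (codeg G u v : ℝ) := by
  simp only [codeg, adjInd, Finset.card_filter, Nat.cast_sum]
  refine Finset.sum_congr rfl fun w _ => ?_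
  by_cases h1 : G.Adj w u <;> by_cases h2 : G.Adj w v <;> simp [h1, h2]

theorem sum_one_sub_adjInd_mul_le {V : Type*} [Fintype V] (G : SimpleGraph V) (u v : V) :
    ∑ w, (1 - adjInd G w u) * (1 - adjInd G w v) ≤
      (codeg Gᶜ u v : ℝ) + 2 := by
  have h : ∑ w, (1 - adjInd G w u) * (1 - adjInd G w v) ≤
      ∑ w, ((if Gᶜ.Adj w u ∧ Gᶜ.Adj w v then (1 : ℝ) else 0) +
        (if w = u then 1 else 0) + (if w = v then 1 else 0)) := by
    refine Finset.sum_le_sum fun w _ => ?_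
    simp only [adjInd, SimpleGraph.compl_adj]
    by_cases h1 : G.Adj w u <;> by_cases h2 : G.Adj w v <;> by_cases h3 : w = u <;>
      by_cases h4 : w = v <;> simp_all
  refine h.trans (le_of_eq ?_)
  rw [Finset.sum_add_distrib, Finset.sum_add_distrib]
  simp only [Finset.sum_ite_eq', Finset.mem_univ, if_true, codeg, Finset.card_filter, Nat.cast_sum]
  push_cast
  ring

end Books

/-! ### The upper bound -/

theorem eventually_ramseyNumber_book_le {α : ℝ} (hα : 1 / 6 ≤ α) {ε : ℝ} (hε : 0 < ε) :
    ∀ᶠ n : ℕ in atTop, (ramseyNumber (book ⌈α * (n : ℝ)⌉₊) (book n) : ℝ) ≤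
      (3 / 2 + 3 * α + ε) * n := by
  set c := 3 / 2 + 3 * α with hc
  have hc2 : 2 ≤ c := by linarith
  set ε' := ε / (4 * (c + ε)) with hε'
  have hε'0 : 0 < ε' := by positivity
  have hε'c : ε' * (c + ε) = ε / 4 := by
    have : c + ε ≠ 0 := by positivity
    rw [hε']; field_simp
  have hε'1 : ε' ≤ 1 / 4 := by
    rw [hε', div_le_iff₀ (by positivity)]
    linarith
  obtain ⟨N₀, hN₀⟩ := exists_forall_not_codegBounded hε'0
  obtain ⟨n₀, hn₀⟩ := exists_nat_ge (20 / ε + N₀ + 1)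
  filter_upwards [eventually_ge_atTop n₀] with n hn
  have hnr : 20 / ε + N₀ + 1 ≤ (n : ℝ) := hn₀.trans (by exact_mod_cast hn)
  have hεpos : 0 < 20 / ε := by positivity
  have hN₀0 : (0 : ℝ) ≤ N₀ := Nat.cast_nonneg _
  have hn1 : 20 ≤ ε * n := by
    have : 20 / ε ≤ n := by linarith
    rwa [div_le_iff₀' hε] at this
  set N := ⌊(c + ε) * n⌋₊ with hN
  have hNle : (N : ℝ) ≤ (c + ε) * n := Nat.floor_le (by positivity)
  have hNge : (c + ε) * n - 1 ≤ N := (Nat.sub_one_lt_floor _).le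
  have hn2 : 2 * (n : ℝ) ≤ c * n := by gcongr
  have hNN₀ : N₀ + 1 ≤ N := by
    have : ((N₀ + 1 : ℕ) : ℝ) ≤ N := by push_cast; linarith
    exact_mod_cast this
  have hNpos : (0 : ℝ) < N := by exact_mod_cast (by omega : 0 < N)
  refine le_trans ?_ hNle
  refine Nat.cast_le.mpr ((isLeast_ramseyNumber _ _).2 ⟨by omega, fun R => ?_⟩)
  by_contra hcon
  obtain ⟨hred, hblue⟩ := not_or.mp hcon
  have hfact : (2 - ε') * ((c + ε) * n - 1) ≤ (2 - ε') * N := by gcongr; linarith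
  have hfact' : (1 / 2 - ε') * ((c + ε) * n - 1) ≤ (1 / 2 - ε') * N := by gcongr; linarith
  have e1 : ε' * (c + ε) * n = ε / 4 * n := by rw [hε'c]
  refine hN₀ R (α * n / N) ((n + 1) / N) (by rw [Fintype.card_fin]; omega) (by positivity)
    (by positivity) ?_ ?_ ⟨fun u v huv => ?_, fun u v hne huv => ?_⟩
  · rw [show 3 * (((n : ℝ) + 1) / N) + 6 * (α * n / N) = (2 * c * n + 3) / N by
      rw [hc]; field_simp; ring, div_le_iff₀ hNpos]
    linarith
  · rw [div_le_iff₀ hNpos]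
    linarith
  · rw [sum_adjInd_mul_adjInd, Fintype.card_fin, div_mul_cancel₀ _ hNpos.ne']
    by_contra! h
    exact hred (book_isContained R huv (Nat.ceil_le.mpr h.le))
  · rw [Fintype.card_fin, div_mul_cancel₀ _ hNpos.ne']
    refine (sum_one_sub_adjInd_mul_le R u v).trans ?_
    by_contra! h
    refine hblue (book_isContained Rᶜ ((SimpleGraph.compl_adj _ _ _).mpr ⟨hne, huv⟩) ?_)
    have : (n : ℝ) < codeg Rᶜ u v + 1 := by linarith
    have : n < codeg Rᶜ u v + 1 := by
      exact_mod_cast this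
    omega

/-! ### Lower bounds from colourings -/

theorem ramseyArrows_mono {V W : Type*} {G : SimpleGraph V} {H : SimpleGraph W} {M N : ℕ}
    (hMN : M ≤ N) (h : RamseyArrows M G H) : RamseyArrows N G H := by
  intro R
  have hemb : (R.comap (Fin.castLE hMN)).IsContained R :=
    ⟨⟨⟨Fin.castLE hMN, fun {a b} h => h⟩, Fin.castLE_injective hMN⟩⟩
  have hemb' : (R.comap (Fin.castLE hMN))ᶜ.IsContained Rᶜ := by
    refine ⟨⟨⟨Fin.castLE hMN, fun {a b} h => ?_⟩, Fin.castLE_injective hMN⟩⟩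
    exact ⟨fun h' => h.1 (Fin.castLE_injective hMN h'), h.2⟩
  rcases h (R.comap (Fin.castLE hMN)) with h | h
  · exact Or.inl (h.trans hemb)
  · exact Or.inr (h.trans hemb')

/-- A graph in which adjacent vertices have few common neighbours and nonadjacent vertices have few
common non-neighbours bounds the Ramsey number of two books from below. -/
theorem card_lt_ramseyNumber_book {V : Type*} [Fintype V] (G : SimpleGraph V) (m n : ℕ)
    (hred : ∀ u v, G.Adj u v →
      codeg G u v < m)
    (hblue : ∀ u v, Gᶜ.Adj u v →
      codeg Gᶜ u v < n) :
    Fintype.card V < ramseyNumber (book m) (book n) := by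
  by_contra! hle
  have harr := ramseyArrows_mono hle (isLeast_ramseyNumber (book m) (book n)).1.2
  let f : Fin (Fintype.card V) ≃ V := (Fintype.equivFin V).symm
  have e1 : (G.comap f).IsContained G := ⟨⟨⟨f, fun {a b} h => h⟩, f.injective⟩⟩
  have e2 : (G.comap f)ᶜ.IsContained Gᶜ :=
    ⟨⟨⟨f, fun {a b} h => ⟨fun h' => h.1 (f.injective h'), h.2⟩⟩, f.injective⟩⟩
  rcases harr (G.comap f) with h | h
  · obtain ⟨u, v, huv, hm⟩ := exists_adj_of_book_isContained (h.trans e1)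
    exact absurd (hred u v huv) (not_lt.mpr hm)
  · obtain ⟨u, v, huv, hm⟩ := exists_adj_of_book_isContained (h.trans e2)
    exact absurd (hblue u v huv) (not_lt.mpr hm)

/-- The complete bipartite graph with parts of size `n` contains no triangle, and its complement
has no vertex of degree `n`. -/
theorem two_mul_lt_ramseyNumber_book {m n : ℕ} (hm : 0 < m) (hn : 0 < n) :
    2 * n < ramseyNumber (book m) (book n) := by
  have := card_lt_ramseyNumber_book (completeBipartiteGraph (Fin n) (Fin n)) m n
    (fun u v huv => ?_) (fun u v huv => ?_)
  · rwa [Fintype.card_sum, Fintype.card_fin, ← two_mul] at this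
  · refine (codeg_le_card ∅ fun w h1 h2 => ?_).trans_lt hm
    rcases u with u | u <;> rcases v with v | v <;> rcases w with w | w <;> simp_all
  · have key : ∀ g : Fin n → Fin n ⊕ Fin n, Function.Injective g → (∃ i, g i = u) →
        (∀ w, w ≠ u → ¬ (completeBipartiteGraph (Fin n) (Fin n)).Adj w u → ∃ i, g i = w) →
        codeg (completeBipartiteGraph (Fin n) (Fin n))ᶜ u v < n := by
      rintro g hg ⟨i₀, hi₀⟩ hw
      calc _ ≤ ((Finset.univ.erase i₀).image g).card := by
            refine codeg_le_card _ fun w ⟨h1, h2⟩ _ => ?_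
            obtain ⟨i, rfl⟩ := hw w h1 h2
            refine Finset.mem_image_of_mem _ (Finset.mem_erase.mpr ⟨?_, Finset.mem_univ _⟩)
            rintro rfl
            exact h1 hi₀
        _ ≤ (Finset.univ.erase i₀).card := Finset.card_image_le
        _ < n := by
            rw [Finset.card_erase_of_mem (Finset.mem_univ _), Finset.card_univ, Fintype.card_fin]
            omega
    rcases u with u | u
    · exact key Sum.inl Sum.inl_injective ⟨u, rfl⟩ (by rintro (w | w) h1 h2 <;> simp_all)
    · exact key Sum.inr Sum.inr_injective ⟨u, rfl⟩ (by rintro (w | w) h1 h2 <;> simp_all)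

/-! ### A quasirandom graph of density one third -/

section Quasirandom

variable {F : Type*} [Field F]

theorem card_filter_quadratic_le (a b c : F) (h : ¬ (a = 0 ∧ b = 0 ∧ c = 0)) (Y : Finset F) :
    (Y.filter fun y => a * y ^ 2 + b * y + c = 0).card ≤ 2 := by
  set p : Polynomial F := Polynomial.C a * Polynomial.X ^ 2 + Polynomial.C b * Polynomial.X
    + Polynomial.C c with hp
  have hp0 : p ≠ 0 := by
    intro h0
    refine h ⟨?_, ?_, ?_⟩
    · simpa [hp, Polynomial.coeff_X, Polynomial.coeff_C] using congrArg (·.coeff 2) h0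
    · simpa [hp, Polynomial.coeff_X, Polynomial.coeff_C] using congrArg (·.coeff 1) h0
    · simpa [hp, Polynomial.coeff_X, Polynomial.coeff_C] using congrArg (·.coeff 0) h0
  calc _ ≤ p.roots.toFinset.card := by
        refine Finset.card_le_card fun y hy => ?_
        rw [Multiset.mem_toFinset, Polynomial.mem_roots hp0, Polynomial.IsRoot.def]
        simpa [hp] using (Finset.mem_filter.mp hy).2
    _ ≤ p.roots.card := Multiset.toFinset_card_le _
    _ ≤ p.natDegree := p.card_roots'
    _ ≤ 2 := Polynomial.natDegree_quadratic_le

/-- The coefficient of `x'` in `pairing (x, y) (x', y')`, for `u = (x, y)` and `t = y'`. -/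
def slope (u : F × F) (t : F) : F := u.1 + u.2 * t + t ^ 2

/-- A symmetric function on `F × F`. For a fixed `u` it is affine in the first coordinate of the
second argument; its slope is a monic quadratic polynomial in the second coordinate and
determines `u`. -/
def pairing (u w : F × F) : F := slope u w.2 * w.1 + (u.2 * w.2 + u.2 ^ 2) * u.1

theorem pairing_comm (u w : F × F) : pairing u w = pairing w u := by
  unfold pairing slope; ring

variable [Algebra (ZMod 3) F]

/-- The graph on `F × Y` in which two vertices are joined if a linear functional vanishes on their
pairing. For large `F` and `Y` it behaves like a random graph of edge density `1 / 3`. -/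
def pairingGraph (l : F →ₗ[ZMod 3] ZMod 3) (Y : Finset F) : SimpleGraph (F × Y) where
  Adj u w := u ≠ w ∧ l (pairing (u.1, (u.2 : F)) (w.1, (w.2 : F))) = 0
  symm := ⟨fun _ _ h => ⟨h.1.symm, by rw [pairing_comm]; exact h.2⟩⟩
  loopless := ⟨fun _ h => h.1 rfl⟩

/-- For distinct `u` and `v`, the slopes of `u` and `v` are linearly independent over `𝔽₃` at all
but at most `16` places: a nontrivial linear combination of them is a nonzero polynomial of degree
at most `2`. -/
theorem card_filter_dependent_slopes_le {u v : F × F} (huv : u ≠ v) (Y : Finset F) :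
    (Y.filter fun t => ∃ p : ZMod 3 × ZMod 3, p ≠ 0 ∧
      p.1 • slope u t + p.2 • slope v t = 0).card ≤ 16 := by
  calc _ ≤ ((Finset.univ.erase (0 : ZMod 3 × ZMod 3)).biUnion fun p =>
        Y.filter fun t => p.1 • slope u t + p.2 • slope v t = 0).card := by
        refine Finset.card_le_card fun t ht => ?_
        obtain ⟨hY, p, hp, h⟩ := Finset.mem_filter.mp ht
        exact Finset.mem_biUnion.mpr ⟨p, by simpa using hp, Finset.mem_filter.mpr ⟨hY, h⟩⟩
    _ ≤ (Finset.univ.erase (0 : ZMod 3 × ZMod 3)).card * 2 := by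
        refine Finset.card_biUnion_le_card_mul _ _ _ fun p hp => ?_
        have hp0 : p ≠ 0 := Finset.ne_of_mem_erase hp
        let φ := algebraMap (ZMod 3) F
        refine le_trans (Finset.card_le_card fun t ht => ?_) (card_filter_quadratic_le
          (φ p.1 + φ p.2) (φ p.1 * u.2 + φ p.2 * v.2) (φ p.1 * u.1 + φ p.2 * v.1) ?_ Y)
        · obtain ⟨hY, h⟩ := Finset.mem_filter.mp ht
          refine Finset.mem_filter.mpr ⟨hY, ?_⟩
          rw [Algebra.smul_def, Algebra.smul_def] at h
          rw [← h]
          simp only [slope, φ]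
          ring
        · rintro ⟨h1, h2, h3⟩
          have hφ : φ p.2 = - φ p.1 := by linear_combination h1
          have hne : φ p.1 ≠ 0 := by
            intro h0
            apply hp0
            rw [h0, neg_zero] at hφ
            exact Prod.ext ((map_eq_zero φ).mp h0) ((map_eq_zero φ).mp hφ)
          rw [hφ] at h2 h3
          apply huv
          refine Prod.ext ?_ ?_
          · exact mul_left_cancel₀ hne (by linear_combination h3)
          · exact mul_left_cancel₀ hne (by linear_combination h2)
    _ = 16 := by
        rw [Finset.card_erase_of_mem (Finset.mem_univ _), Finset.card_univ, Fintype.card_prod,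
          ZMod.card]

theorem exists_linearMap_ne_zero : ∃ l : F →ₗ[ZMod 3] ZMod 3, l ≠ 0 := by
  by_contra! h
  exact one_ne_zero ((Module.forall_dual_apply_eq_zero_iff (ZMod 3) (1 : F)).mp fun f => by
    rw [h f]; rfl)

variable [Fintype F]

/-- For `a`, `b` linearly independent over `𝔽₃`, the values `(l (a x), l (b x))` of a nonzero linear
functional `l` are exactly equidistributed over `𝔽₃ × 𝔽₃`. -/
theorem nine_mul_card_filter (l : F →ₗ[ZMod 3] ZMod 3) (hl : l ≠ 0) {a b : F}
    (hab : ∀ j k : ZMod 3, j • a + k • b = 0 → j = 0 ∧ k = 0) (S : Finset (ZMod 3 × ZMod 3)) :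
    9 * (Finset.univ.filter fun x : F => (l (a * x), l (b * x)) ∈ S).card
      = Fintype.card F * S.card := by
  let L : F →ₗ[ZMod 3] ZMod 3 × ZMod 3 :=
    (l ∘ₗ LinearMap.mulLeft (ZMod 3) a).prod (l ∘ₗ LinearMap.mulLeft (ZMod 3) b)
  have hL : ∀ x, L x = (l (a * x), l (b * x)) := fun x => rfl
  obtain ⟨x₀, hx₀⟩ : ∃ x, l x ≠ 0 := by
    by_contra! h
    exact hl (LinearMap.ext h)
  have hsurj : LinearMap.range L = ⊤ := by
    by_contra hne
    obtain ⟨f, hf, hle⟩ := Submodule.exists_le_ker_of_lt_top _ (lt_top_iff_ne_top.mpr hne)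
    have hfval : ∀ y z : ZMod 3, f (y, z) = f (1, 0) * y + f (0, 1) * z := by
      intro y z
      have : ((y, z) : ZMod 3 × ZMod 3) = y • (1, 0) + z • (0, 1) := by simp
      rw [this, map_add, map_smul, map_smul, smul_eq_mul, smul_eq_mul]
      ring
    have hzero : ∀ x, l ((f (1, 0) • a + f (0, 1) • b) * x) = 0 := by
      intro x
      have h1 : f (L x) = 0 := hle ⟨x, rfl⟩
      rw [hL, hfval] at h1
      rw [add_mul, smul_mul_assoc, smul_mul_assoc, map_add, map_smul, map_smul]
      exact h1
    have h0 : f (1, 0) • a + f (0, 1) • b = 0 := by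
      by_contra h
      apply hx₀
      rw [← hzero ((f (1, 0) • a + f (0, 1) • b)⁻¹ * x₀), mul_inv_cancel_left₀ h]
    obtain ⟨h1, h2⟩ := hab _ _ h0
    exact hf (LinearMap.ext fun ⟨y, z⟩ => by rw [hfval, h1, h2]; simp)
  have hfib : ∀ p p' : ZMod 3 × ZMod 3, (Finset.univ.filter fun x => L x = p).card =
      (Finset.univ.filter fun x => L x = p').card := by
    intro p p'
    exact AddMonoidHom.card_fiber_eq_of_mem_range L.toAddMonoidHom
      (LinearMap.range_eq_top.mp hsurj p) (LinearMap.range_eq_top.mp hsurj p')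
  have htot : ∀ S : Finset (ZMod 3 × ZMod 3), (Finset.univ.filter fun x : F => L x ∈ S).card =
      S.card * (Finset.univ.filter fun x => L x = 0).card := by
    intro S
    refine (Finset.card_eq_sum_card_fiberwise (s := Finset.univ.filter fun x : F => L x ∈ S)
      (f := L) (t := S) fun x hx => by simpa using hx).trans (Finset.sum_const_nat fun p hp => ?_)
    rw [hfib 0 p]
    congr 1
    ext x
    simp only [Finset.mem_filter, Finset.mem_univ, true_and]
    exact ⟨fun h => h.2, fun h => ⟨h ▸ hp, h⟩⟩
  have huniv := htot Finset.univ
  simp only [Finset.mem_univ, Finset.filter_true, Finset.card_univ, Fintype.card_prod,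
    ZMod.card] at huniv
  have := htot S
  simp only [hL] at this huniv ⊢
  rw [this, huniv]
  ring

/-- The pairs of values of `l` on the pairings of two distinct vertices `u`, `v` with the other
vertices are nearly equidistributed over `𝔽₃ × 𝔽₃`. -/
theorem nine_mul_card_filter_pairing_le (l : F →ₗ[ZMod 3] ZMod 3) (hl : l ≠ 0) (Y : Finset F)
    {u v : F × F} (huv : u ≠ v) (S : Finset (ZMod 3)) :
    9 * (Finset.univ.filter fun w : F × Y => l (pairing u (w.1, (w.2 : F))) ∈ S ∧
      l (pairing v (w.1, (w.2 : F))) ∈ S).card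
      ≤ Fintype.card F * (S.card ^ 2 * Y.card + 144) := by
  set B := Y.filter fun t => ∃ p : ZMod 3 × ZMod 3, p ≠ 0 ∧
      p.1 • slope u t + p.2 • slope v t = 0 with hB
  have hfib : ∀ t ∈ Y, 9 * (Finset.univ.filter fun x : F =>
      l (pairing u (x, t)) ∈ S ∧ l (pairing v (x, t)) ∈ S).card ≤
      Fintype.card F * (S.card ^ 2 + if t ∈ B then 9 else 0) := by
    intro t ht
    split_ifs with htB
    · have : (Finset.univ.filter fun x : F =>
        l (pairing u (x, t)) ∈ S ∧ l (pairing v (x, t)) ∈ S).card ≤ Fintype.card F :=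
        Finset.card_le_univ _
      nlinarith [Nat.zero_le (Fintype.card F * S.card ^ 2)]
    · have hind : ∀ j k : ZMod 3, j • slope u t + k • slope v t = 0 → j = 0 ∧ k = 0 := by
        intro j k h
        by_contra hjk
        exact htB (Finset.mem_filter.mpr ⟨ht, (j, k), fun h0 => hjk (by simpa using h0), h⟩)
      set cu := l ((u.2 * t + u.2 ^ 2) * u.1) with hcu
      set cv := l ((v.2 * t + v.2 ^ 2) * v.1) with hcv
      have := nine_mul_card_filter l hl hind
        ((S.image fun s => s - cu) ×ˢ (S.image fun s => s - cv))
      rw [Finset.card_product, Finset.card_image_of_injective _ (sub_left_injective),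
        Finset.card_image_of_injective _ (sub_left_injective)] at this
      rw [add_zero, sq, ← this]
      refine Nat.mul_le_mul_left _ (Finset.card_le_card fun x hx => ?_)
      obtain ⟨-, h1, h2⟩ := Finset.mem_filter.mp hx
      refine Finset.mem_filter.mpr ⟨Finset.mem_univ _, Finset.mem_product.mpr
        ⟨Finset.mem_image.mpr ⟨_, h1, ?_⟩, Finset.mem_image.mpr ⟨_, h2, ?_⟩⟩⟩
      · simp only [pairing, map_add, hcu]; ring
      · simp only [pairing, map_add, hcv]; ring
  have hsplit : (Finset.univ.filter fun w : F × Y => l (pairing u (w.1, (w.2 : F))) ∈ S ∧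
      l (pairing v (w.1, (w.2 : F))) ∈ S).card = ∑ t ∈ Y, (Finset.univ.filter fun x : F =>
        l (pairing u (x, t)) ∈ S ∧ l (pairing v (x, t)) ∈ S).card := by
    simp_rw [Finset.card_filter]
    rw [Fintype.sum_prod_type, Finset.sum_comm, ← Finset.sum_coe_sort Y]
  rw [hsplit, Finset.mul_sum]
  refine (Finset.sum_le_sum hfib).trans ?_
  rw [← Finset.mul_sum, Finset.sum_add_distrib, Finset.sum_ite_mem,
    Finset.inter_eq_right.mpr (Finset.filter_subset _ _)]
  have hB16 : B.card ≤ 16 := card_filter_dependent_slopes_le huv Y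
  refine Nat.mul_le_mul_left _ ?_
  simp only [Finset.sum_const, smul_eq_mul]
  nlinarith

end Quasirandom

/-- The pairing graph on `F × Y` with `|F| = 3 ^ j` and `|Y| = k` contains no `B_m`, and its
complement contains no `B_n`. The summand `144 = 9 * 16` accounts for the places where the slopes of
two vertices are dependent. -/
theorem mul_lt_ramseyNumber_book {j k m n : ℕ} (hj : j ≠ 0) (hk : k ≤ 3 ^ j)
    (hm : 3 ^ j * (k + 144) < 9 * m) (hn : 4 * (3 ^ j * (k + 144)) < 9 * n) :
    3 ^ j * k < ramseyNumber (book m) (book n) := by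
  have : Fintype (GaloisField 3 j) := Fintype.ofFinite _
  have hF : Fintype.card (GaloisField 3 j) = 3 ^ j := by
    rw [← Nat.card_eq_fintype_card, GaloisField.card 3 j hj]
  obtain ⟨Y, -, hY⟩ := Finset.exists_subset_card_eq
    (s := (Finset.univ : Finset (GaloisField 3 j))) (n := k)
    (by rw [Finset.card_univ, hF]; exact hk)
  obtain ⟨l, hl⟩ := exists_linearMap_ne_zero (F := GaloisField 3 j)
  have hne : ∀ {u v : GaloisField 3 j × Y}, u ≠ v →
      (u.1, (u.2 : GaloisField 3 j)) ≠ (v.1, (v.2 : GaloisField 3 j)) := by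
    intro u v huv h
    obtain ⟨h1, h2⟩ := Prod.mk.inj h
    exact huv (Prod.ext h1 (Subtype.ext h2))
  have hlt := card_lt_ramseyNumber_book (pairingGraph l Y) m n (fun u v huv => ?_)
    (fun u v huv => ?_)
  · rwa [Fintype.card_prod, hF, Fintype.card_coe, hY] at hlt
  · have h := nine_mul_card_filter_pairing_le l hl Y (hne huv.ne) {0}
    rw [hF, hY, Finset.card_singleton] at h
    refine lt_of_mul_lt_mul_left (a := 9) (lt_of_le_of_lt ?_ hm) (by norm_num)
    refine le_trans (Nat.mul_le_mul_left 9 ?_) (h.trans_eq (by ring))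
    refine codeg_le_card _ fun w ⟨_, h1⟩ ⟨_, h2⟩ => Finset.mem_filter.mpr ?_
    rw [pairing_comm] at h1 h2
    simp [h1, h2]
  · have h := nine_mul_card_filter_pairing_le l hl Y (hne huv.ne) (Finset.univ.erase 0)
    rw [hF, hY, Finset.card_erase_of_mem (Finset.mem_univ _), Finset.card_univ, ZMod.card] at h
    refine lt_of_mul_lt_mul_left (a := 9) (lt_of_le_of_lt ?_ hn) (by norm_num)
    refine le_trans (Nat.mul_le_mul_left 9 ?_) (h.trans (by
      have : 0 ≤ 3 ^ j := Nat.zero_le _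
      nlinarith))
    refine codeg_le_card _ fun w ⟨h1, h1'⟩ ⟨h2, h2'⟩ => Finset.mem_filter.mpr ?_
    have e1 : l (pairing (u.1, (u.2 : GaloisField 3 j)) (w.1, (w.2 : GaloisField 3 j))) ≠ 0 :=
      fun h => h1' ⟨h1, by rw [pairing_comm]; exact h⟩
    have e2 : l (pairing (v.1, (v.2 : GaloisField 3 j)) (w.1, (w.2 : GaloisField 3 j))) ≠ 0 :=
      fun h => h2' ⟨h2, by rw [pairing_comm]; exact h⟩
    simp [e1, e2]

theorem eventually_le_ramseyNumber_book_quarter {ε : ℝ} (hε : 0 < ε) :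
    ∀ᶠ n : ℕ in atTop,
      (9 / 4 - ε) * (n : ℝ) ≤ ramseyNumber (book ⌈(1 / 4 : ℝ) * (n : ℝ)⌉₊) (book n) := by
  obtain ⟨n₀, hn₀⟩ := exists_nat_ge (147 ^ 2 * 27 / ε ^ 2)
  filter_upwards [eventually_ge_atTop (max n₀ 1)] with n hn
  have hn1 : 1 ≤ n := (le_max_right _ _).trans hn
  have hnr : 147 ^ 2 * 27 / ε ^ 2 ≤ (n : ℝ) :=
    hn₀.trans (by exact_mod_cast (le_max_left _ _).trans hn)
  rw [div_le_iff₀ (by positivity)] at hnr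
  -- `q = 3 ^ j` has order of magnitude `√n`
  set j := Nat.clog 9 (3 * n) with hj
  have hj0 : 0 < j := Nat.clog_pos (by norm_num) (by omega)
  have hq1 : 3 * n ≤ (3 ^ j) ^ 2 := by
    rw [← pow_mul, mul_comm j 2, pow_mul]
    exact Nat.le_pow_clog (by norm_num) _
  have hq2 : (3 ^ j) ^ 2 < 27 * n := by
    rw [← pow_mul, mul_comm j 2, pow_mul]
    have h := Nat.pow_pred_clog_lt_self (b := 9) (by norm_num) (x := 3 * n) (by omega)
    rw [← hj] at h
    obtain ⟨i, hi⟩ : ∃ i, j = i + 1 := ⟨j - 1, by omega⟩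
    rw [hi, pow_succ]
    rw [hi, Nat.pred_succ] at h
    norm_num at h ⊢
    omega
  set q := 3 ^ j with hq
  have hqpos : 0 < q := by positivity
  have hqr : 147 * (q : ℝ) ≤ ε * n := by
    have h1 : (q : ℝ) ^ 2 < 27 * n := by exact_mod_cast hq2
    refine (pow_le_pow_iff_left₀ (by positivity) (by positivity) two_ne_zero).mp ?_
    have : (0 : ℝ) < n := by exact_mod_cast hn1
    nlinarith
  have hd1 : 4 * q * (9 * n / (4 * q)) ≤ 9 * n := Nat.mul_div_le _ _
  have hd2 : 9 * n < 4 * q * (9 * n / (4 * q) + 1) :=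
    Nat.lt_mul_div_succ _ (by positivity)
  set d := 9 * n / (4 * q) with hd
  have hd2r : 9 * (n : ℝ) < 4 * q * (d + 1) := by exact_mod_cast hd2
  have hr0 : (0 : ℝ) ≤ ramseyNumber (book ⌈(1 / 4 : ℝ) * (n : ℝ)⌉₊) (book n) := Nat.cast_nonneg _
  rcases lt_or_ge d 146 with hlt | hge
  · have : (d : ℝ) + 1 ≤ 146 := by exact_mod_cast hlt
    have hq0 : (0 : ℝ) < q := by exact_mod_cast hqpos
    nlinarith
  · obtain ⟨k, hk⟩ : ∃ k, d = k + 146 := ⟨d - 146, by omega⟩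
    have hlt4 : 4 * (q * (k + 144)) < 9 * n := by
      rw [hk] at hd1
      nlinarith
    have hkq : k ≤ q := by nlinarith
    have hceil : n ≤ 4 * ⌈(1 / 4 : ℝ) * (n : ℝ)⌉₊ := by
      have := Nat.le_ceil ((1 / 4 : ℝ) * (n : ℝ))
      have : (n : ℝ) ≤ 4 * (⌈(1 / 4 : ℝ) * (n : ℝ)⌉₊ : ℝ) := by linarith
      exact_mod_cast this
    have h := mul_lt_ramseyNumber_book (m := ⌈(1 / 4 : ℝ) * (n : ℝ)⌉₊) (n := n) hj0.ne' hkq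
      (by rw [← hq]; omega) hlt4
    have hr : (q : ℝ) * k ≤ ramseyNumber (book ⌈(1 / 4 : ℝ) * (n : ℝ)⌉₊) (book n) := by
      exact_mod_cast h.le
    have hkd : (d : ℝ) = k + 146 := by exact_mod_cast hk
    rw [hkd] at hd2r
    nlinarith

/-! ### Asymptotics -/

theorem isLittleO_of_eventually_abs_le {f : ℕ → ℝ}
    (h : ∀ ε : ℝ, 0 < ε → ∀ᶠ n : ℕ in atTop, |f n| ≤ ε * n) :
    f =o[atTop] (fun n : ℕ => (n : ℝ)) :=
  isLittleO_iff.mpr fun ε hε => (h ε hε).mono fun n hn => by simpa using hn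

end BookRamsey

open BookRamsey in
theorem theorem4 (α : ℝ) (hα₁ : 1 / 6 ≤ α) (hα₂ : α ≤ 1 / 4) :
    (∃ f : ℕ → ℝ, f =o[atTop] (fun n : ℕ => (n : ℝ)) ∧
      ∀ᶠ n : ℕ in atTop,
        (ramseyNumber (book ⌈α * (n : ℝ)⌉₊) (book n) : ℝ) ≤ (3 / 2 + 3 * α) * (n : ℝ) + f n) ∧
    (α = 1 / 6 ∨ α = 1 / 4 →
      ∃ g : ℕ → ℝ, g =o[atTop] (fun n : ℕ => (n : ℝ)) ∧
        ∀ᶠ n : ℕ in atTop,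
          (ramseyNumber (book ⌈α * (n : ℝ)⌉₊) (book n) : ℝ)
            = (3 / 2 + 3 * α) * (n : ℝ) + g n) := by
  set r : ℕ → ℝ := fun n => (ramseyNumber (book ⌈α * (n : ℝ)⌉₊) (book n) : ℝ) with hr
  refine ⟨⟨fun n => max 0 (r n - (3 / 2 + 3 * α) * n), isLittleO_of_eventually_abs_le
    fun ε hε => ?_, .of_forall fun n => ?_⟩, fun hα => ⟨fun n => r n - (3 / 2 + 3 * α) * n,
    isLittleO_of_eventually_abs_le fun ε hε => ?_, .of_forall fun n => by ring⟩⟩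
  · filter_upwards [eventually_ramseyNumber_book_le hα₁ hε] with n hn
    rw [abs_of_nonneg (le_max_left _ _)]
    exact max_le (by positivity) (by linarith)
  · linarith [le_max_right 0 (r n - (3 / 2 + 3 * α) * n)]
  · have hlow : ∀ᶠ n : ℕ in atTop, (3 / 2 + 3 * α - ε) * n ≤ r n := by
      rcases hα with rfl | rfl
      · filter_upwards [eventually_ge_atTop 1] with n hn
        have hpos : 0 < ⌈(1 / 6 : ℝ) * (n : ℝ)⌉₊ :=
          Nat.ceil_pos.mpr (by positivity)
        have h : (2 : ℝ) * n ≤ r n := by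
          have h' : ((2 * n : ℕ) : ℝ) ≤ r n :=
            Nat.cast_le.mpr (two_mul_lt_ramseyNumber_book hpos hn).le
          rwa [Nat.cast_mul, Nat.cast_ofNat] at h'
        have : 0 ≤ ε * n := by positivity
        linarith
      · filter_upwards [eventually_le_ramseyNumber_book_quarter hε] with n hn
        linarith
    filter_upwards [eventually_ramseyNumber_book_le hα₁ hε, hlow] with n h1 h2
    exact abs_le.mpr ⟨by linarith, by linarith⟩
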